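/- **Tree Trimming.** *Setup.* Let $(\mathcal X,\mathfrak S)$ be a hierarchically hyperbolic space (Behrstock–Hagen–Sisto axioms, with point-valued, coarsely surjective projections $\pi_U:\mathcal X\to\mathcal C(U)$), with nesting $\sqsubset$, orthogonality $\perp$, transversality $\pitchfork$ and relative projections $\rho^V_U$. For $a,b\in\mathcal X$ and $K>0$ let $\mathcal U=\mathrm{Rel}_K(a,b)=\{U\in\mathfrak S: d_{\mathcal C(U)}(\pi_U(a),\pi_U(b))>K\}$. An *$R$-interval system* for $a,b$ consists of: for each $U\in\mathcal U$, a compact interval $T_U$, an $(R,R)$-quasi-isometric embedding $\phi_U:T_U\to\mathcal C(U)$ whose image is within Hausdorff distance $R$ of the union of the geodesics from $\pi_U(a)$ to $\pi_U(b)$, and marked points $a_U,b_U\in T_U$ with $\phi_U(a_U)$, $\phi_U(b_U)$ within $R$ of $\pi_U(a)$, $\pi_U(b)$; nonempty sets $\delta^V_U\subset T_U$ for $V\sqsubset U$ or $V\pitchfork U$, of diameter at most $R$ and with $\phi_U(\delta^V_U)$ within $R$ of $\rho^V_U$, which are $R$-close to a marked point if $V\pitchfork U$; and (set-valued) maps $\delta^V_U:T_V\to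 T_U$ for $U\sqsubset V$; such that (i) if $U,V\sqsubset W$ are not transverse, then $\mathrm{diam}(\delta^U_W\cup\delta^V_W)\le R$; (ii) if $U\pitchfork V$, $W\sqsubset V$ and $W\not\perp U$, then $\mathrm{diam}(\delta^V_U\cup\delta^W_U)\le R$; (iii) if $U\sqsubset V$ and $c$ is a component of the complement of the $R$-neighbourhood of $\delta^U_V$ in $T_V$, then $\mathrm{diam}(\delta^V_U(c))\le R$; (iv) if $U\sqsubset V$ and $t\in T_V$ is at distance more than $R$ from $\delta^U_V$, then $\phi_U(\delta^V_U(t))$ lies within $R$ of $\rho^V_U(\phi_V(t))$. The *cluster part* of $T_U$ is the union of the $r_1$-neighbourhoods of $a_U$, $b_U$ and the $\delta^V_U$ ($V\sqsubset U$), together with all segments between points of this union at distance at most $r_2$. Collapsing each component of it to a point gives $q_U:T_U\to\widehat T_U$; the *edge components* of $\widehat T_U$ are the components of the complement of the collapsed points. Put $\hat\delta^V_U=q_U(\delta^V_U)$ for $V\sqsubset U$ or $V\pitchfork U$, and $\hat\delta^V_U=q_U\circ\delta^V_U\circ q_V^{-1}$ for $U\sqsubset V$. A tuple $\hat x\in\prod_{U\in\mathcal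 U}\widehat T_U$ is *$0$-consistent* if $\hat x_U=\hat\delta^V_U$ or $\hat x_V=\hat\delta^U_V$ whenever $U\pitchfork V$, and $\hat x_V=\hat\delta^U_V$ or $\hat x_U\in\hat\delta^V_U(\hat x_V)$ whenever $U\sqsubset V$. Let $\mathcal Q$ be the set of $0$-consistent tuples, with the $\ell^1$ distance. A *$B$-admissible trimming setup* is a collection of nondegenerate compact subintervals, each contained in the closure of an edge component of some $\widehat T_U$, each of length less than $B$, with at most $B$ of them in (the closure of) any one edge component. Let $\Delta_U:\widehat T_U\to\widehat T_{U,0}$ collapse (the components of the union of) the trimming intervals in $\widehat T_U$ to points, let $\Delta$ be the product of the maps $\Delta_U$, put $(\hat\delta^V_U)_0=\Delta_U(\hat\delta^V_U)$ for $V\sqsubset U$ or $V\pitchfork U$ and $(\hat\delta^V_U)_0=\Delta_U\circ\hat\delta^V_U\circ\Delta_V^{-1}$ for $U\sqsubset V$, and let $\mathcal Q'\subset\prod_{U}\widehat T_{U,0}$ be the corresponding set of $0$-consistent tuples, with the $\ell^1$ distance. *Theorem.* There is $K_0=K_0(\mathfrak S)>0$ such that for every $R>0$ there are $R_1,R_2>0$,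 depending on $\mathfrak S$ and $R$, such that for all $r_1>R_1$ and $r_2>R_2$ there are thresholds $B_{tt}(K)>0$ for $K\ge K_0$, with $B_{tt}(K)\to\infty$ as $K\to\infty$, and constants $L(B)>0$ for $B>0$ (both depending also on $\mathfrak S,R,r_1,r_2$, but $L(B)$ not on $K$) with the following property. For all $K\ge K_0$, all $0<B<B_{tt}(K)$, all $a,b\in\mathcal X$, every $R$-interval system for $a,b$ and $\mathcal U=\mathrm{Rel}_K(a,b)$, and every $B$-admissible trimming setup on the collapsed intervals of its $(r_1,r_2)$-thickening, the set $\mathcal U$ is finite and: 1. $\Delta(\mathcal Q)\subset\mathcal Q'$; 2. there is a map $\Xi:\mathcal Q'\to\mathcal Q$ with $\Delta\circ\Xi=\mathrm{id}_{\mathcal Q'}$; in particular $\Delta(\mathcal Q)=\mathcal Q'$; 3. $\Delta:\mathcal Q\to\mathcal Q'$ is an $(L(B),L(B))$-quasi-isometry. -/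

import Mathlib

open Set Filter MeasureTheory

universe u v w

/-! ### Coarse geometry -/

/-- `f` restricted to `s` is an `(A, A')`-quasi-isometric embedding. -/
def IsQIEmbeddingOn {α β : Type*} [PseudoMetricSpace α] [PseudoMetricSpace β]
    (A A' : ℝ) (s : Set α) (f : α → β) : Prop :=
  ∀ x ∈ s, ∀ y ∈ s, A⁻¹ * dist x y - A' ≤ dist (f x) (f y) ∧ dist (f x) (f y) ≤ A * dist x y + A'

/-- `f : Q → Q'` is an `(L, L)`-quasi-isometry for the distances `d` on `Q` and `d'` on `Q'`. -/
def IsQuasiIsometry {α β : Type*} (L : ℝ) (Q : Set α) (Q' : Set β)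
    (d : α → α → ℝ) (d' : β → β → ℝ) (f : α → β) : Prop :=
  MapsTo f Q Q' ∧
  (∀ x ∈ Q, ∀ y ∈ Q, L⁻¹ * d x y - L ≤ d' (f x) (f y) ∧ d' (f x) (f y) ≤ L * d x y + L) ∧
  ∀ z ∈ Q', ∃ x ∈ Q, d' (f x) z ≤ L

/-- `γ`, restricted to `[0, dist x y]`, is a geodesic from `x` to `y`. -/
def IsGeodesic {α : Type*} [PseudoMetricSpace α] (γ : ℝ → α) (x y : α) : Prop :=
  γ 0 = x ∧ γ (dist x y) = y ∧
  ∀ s ∈ Icc 0 (dist x y), ∀ t ∈ Icc 0 (dist x y), dist (γ s) (γ t) = |s - t|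

/-- The union of all geodesics from `x` to `y`. -/
def geodesicHull {α : Type*} [PseudoMetricSpace α] (x y : α) : Set α :=
  {z | ∃ γ : ℝ → α, IsGeodesic γ x y ∧ ∃ t ∈ Icc 0 (dist x y), γ t = z}

/-- A geodesic space all of whose geodesic triangles are `E`-slim. -/
def IsHyperbolicSpace (E : ℝ) (α : Type*) [PseudoMetricSpace α] : Prop :=
  (∀ x y : α, ∃ γ : ℝ → α, IsGeodesic γ x y) ∧
  ∀ (x y z : α) (γ₁ γ₂ γ₃ : ℝ → α),
    IsGeodesic γ₁ x y → IsGeodesic γ₂ y z → IsGeodesic γ₃ x z →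
    ∀ t ∈ Icc 0 (dist x y),
      (∃ s ∈ Icc 0 (dist y z), dist (γ₁ t) (γ₂ s) ≤ E) ∨
      (∃ s ∈ Icc 0 (dist x z), dist (γ₁ t) (γ₃ s) ≤ E)

/-! ### Hierarchically hyperbolic spaces -/

/-- Two domains are transverse when they are neither nested (in either way) nor orthogonal. -/
def TransverseRel {S : Type*} [PartialOrder S] (orth : S → S → Prop) (U V : S) : Prop :=
  ¬ U ≤ V ∧ ¬ V ≤ U ∧ ¬ orth U V

/-- A hierarchically hyperbolic structure on `X`, in the sense of Behrstock, Hagen and Sisto, with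
set of domains `S`, hyperbolic spaces `C U` and nesting `≤`; as usual the projections are
normalised to be point-valued and coarsely surjective, and one constant `E` is used in all the
axioms. `rho V W` is the set `ρ^V_W ⊆ C W` (meaningful when `V < W` or `V`, `W` are transverse)
and `rhoMap W V` is the map `ρ^W_V : C W → C V` (meaningful when `V < W`). -/
structure HHS (X : Type u) [MetricSpace X] (S : Type v) [PartialOrder S]
    (C : S → Type w) [∀ U, MetricSpace (C U)] where
  E : ℝ
  one_le_E : 1 ≤ E
  quasigeodesic : ∀ x y : X, ∃ l : ℝ, 0 ≤ l ∧ ∃ γ : ℝ → X,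
    γ 0 = x ∧ γ l = y ∧ IsQIEmbeddingOn E E (Icc 0 l) γ
  hyperbolic : ∀ U, IsHyperbolicSpace E (C U)
  /-- projections -/
  proj : ∀ U, X → C U
  proj_lipschitz : ∀ U x y, dist (proj U x) (proj U y) ≤ E * dist x y + E
  proj_coarselySurjective : ∀ U (p : C U), ∃ x, dist (proj U x) p ≤ E
  /-- nesting -/
  exists_top : Nonempty S → ∃ M : S, ∀ U, U ≤ M
  /-- orthogonality -/
  orth : S → S → Prop
  orth_symm : ∀ U V, orth U V → orth V U
  orth_not_le : ∀ U V, orth U V → ¬ U ≤ V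
  orth_of_le : ∀ U V W, V ≤ W → orth W U → orth V U
  orth_container : ∀ T U, U ≤ T → (∃ V, V ≤ T ∧ orth V U) →
    ∃ W, W < T ∧ ∀ V, V ≤ T → orth V U → V ≤ W
  /-- relative projections -/
  rho : ∀ _V W : S, Set (C W)
  rhoMap : ∀ W V : S, C W → C V
  rho_nonempty : ∀ V W, (V < W ∨ TransverseRel orth V W) → (rho V W).Nonempty
  rho_diam : ∀ V W, (V < W ∨ TransverseRel orth V W) → ∀ p ∈ rho V W, ∀ q ∈ rho V W, dist p q ≤ E
  /-- consistency -/
  consistent_transverse : ∀ V W, TransverseRel orth V W → ∀ x,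
    (∃ p ∈ rho V W, dist (proj W x) p ≤ E) ∨ (∃ p ∈ rho W V, dist (proj V x) p ≤ E)
  consistent_nested : ∀ V W, V < W → ∀ x,
    (∃ p ∈ rho V W, dist (proj W x) p ≤ E) ∨ dist (proj V x) (rhoMap W V (proj W x)) ≤ E
  rho_close : ∀ U V W, U ≤ V → (V < W ∨ (TransverseRel orth V W ∧ ¬ orth W U)) →
    ∃ p ∈ rho U W, ∃ q ∈ rho V W, dist p q ≤ E
  /-- finite complexity -/
  complexity : ℕ
  chain_bound : ∀ F : Finset S, (∀ U ∈ F, ∀ V ∈ F, U ≤ V ∨ V ≤ U) → F.card ≤ complexity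
  /-- large links -/
  large_links : ∀ W x y, ∃ F : Finset S,
    (F.card : ℝ) ≤ E * dist (proj W x) (proj W y) + E ∧
    (∀ T ∈ F, T < W ∧
      ∃ p ∈ rho T W, dist (proj W x) p ≤ E * dist (proj W x) (proj W y) + E) ∧
    ∀ T, T < W → (∃ T' ∈ F, T ≤ T') ∨ dist (proj T x) (proj T y) < E
  /-- bounded geodesic image -/
  bounded_geodesic_image : ∀ V W, V < W → ∀ (x y : C W) (γ : ℝ → C W), IsGeodesic γ x y →
    (∃ t ∈ Icc 0 (dist x y), ∃ p ∈ rho V W, dist (γ t) p ≤ E) ∨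
    ∀ s ∈ Icc 0 (dist x y), ∀ t ∈ Icc 0 (dist x y),
      dist (rhoMap W V (γ s)) (rhoMap W V (γ t)) ≤ E
  /-- partial realization, for the points `proj V (z V)` with `V` in the family `F` -/
  partial_realization : ∀ F : Set S, F.Pairwise orth → ∀ z : S → X, ∃ x : X, ∀ V ∈ F,
    dist (proj V x) (proj V (z V)) ≤ E ∧
    ∀ W, (V < W ∨ TransverseRel orth V W) → ∃ p ∈ rho V W, dist (proj W x) p ≤ E
  /-- uniqueness -/
  uniqueness : ∀ κ : ℝ, ∃ θ : ℝ, ∀ x y : X, θ ≤ dist x y → ∃ V, κ ≤ dist (proj V x) (proj V y)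

namespace HHS

variable {X : Type u} [MetricSpace X] {S : Type v} [PartialOrder S]
  {C : S → Type w} [∀ U, MetricSpace (C U)]

/-- `U ⋔ V`. -/
def Transverse (H : HHS X S C) (U V : S) : Prop := TransverseRel H.orth U V

/-- The `K`-relevant domains of `a, b`. -/
def Rel (H : HHS X S C) (K : ℝ) (a b : X) : Set S :=
  {U | K < dist (H.proj U a) (H.proj U b)}

end HHS

/-! ### Families of intervals with relative projections -/

/-- A family of subsets of `ℝ` (below: compact intervals `T U`) with relative projections:
`pt V U` is the projection `δ^V_U ⊆ T U` of `V` to `U` (used when `V ⊏ U` or `V ⋔ U`), and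
`map V U` is the set-valued projection `δ^V_U : T V → T U` (used when `U ⊏ V`). -/
structure IntervalFamily (ι : Type*) where
  carrier : ι → Set ℝ
  pt : ∀ _V _U : ι, Set ℝ
  map : ∀ _V _U : ι, ℝ → Set ℝ

namespace IntervalFamily

variable {ι : Type*}

/-- The family obtained by applying `f U : T U → ℝ` in each coordinate: the intervals are the
images `f U (T U)`, and the projections become `f U (δ^V_U)` and `f U ∘ δ^V_U ∘ (f V)⁻¹`. -/
def push (F : IntervalFamily ι) (f : ι → ℝ → ℝ) : IntervalFamily ι where
  carrier U := f U '' F.carrier U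
  pt V U := f U '' F.pt V U
  map V U y := f U '' ⋃ s ∈ {s | s ∈ F.carrier V ∧ f V s = y}, F.map V U s

/-- The set of `0`-consistent tuples of a family of intervals indexed by domains of an HHS. -/
def zeroConsistent [PartialOrder ι] (F : IntervalFamily ι) (transverse : ι → ι → Prop) :
    Set (ι → ℝ) :=
  {x | (∀ U, x U ∈ F.carrier U) ∧
    (∀ U V, transverse U V → x U ∈ F.pt V U ∨ x V ∈ F.pt U V) ∧
    (∀ U V, U < V → x V ∈ F.pt U V ∨ x U ∈ F.map V U (x V))}

end IntervalFamily

/-- The `ℓ¹` distance on (subsets of) a finite product of intervals. -/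
noncomputable def l1Dist {ι : Type*} (x y : ι → ℝ) : ℝ := ∑ᶠ U, |x U - y U|

/-- The map collapsing each component of `A` to a point, for `A` a finite union of compact
subintervals of an interval `[0, l]`: the quotient interval is identified with an interval `[0, l']`
by the length that remains to the left of a point, so that `s ≤ t` in `[0, l]` have the same image
exactly when `s = t` or `[s, t] ⊆ A`, and the distance of their images is the length of
`[s, t] \ A`. -/
noncomputable def collapse (A : Set ℝ) (t : ℝ) : ℝ := (volume (Icc 0 t \ A)).toReal

/-! ### Interval systems -/

section
variable {X : Type u} [MetricSpace X] {S : Type v} [PartialOrder S]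
  {C : S → Type w} [∀ U, MetricSpace (C U)]

/-- An `R`-interval system for `a, b` and the set of domains `H.Rel K a b`. The interval `T U` is
`[0, len U]`; `δ V U` is `δ^V_U ⊆ T U`, and `δmap V U` is `δ^V_U : T V → T U`. -/
structure IntervalSystem (H : HHS X S C) (R K : ℝ) (a b : X) where
  len : H.Rel K a b → ℝ
  len_nonneg : ∀ U, 0 ≤ len U
  φ : ∀ U : H.Rel K a b, ℝ → C U
  φ_qi : ∀ U : H.Rel K a b, IsQIEmbeddingOn R R (Icc 0 (len U)) (φ U)
  φ_near_hull : ∀ U : H.Rel K a b, ∀ t ∈ Icc 0 (len U),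
    ∃ z ∈ geodesicHull (H.proj U a) (H.proj U b), dist (φ U t) z ≤ R
  hull_near_φ : ∀ U : H.Rel K a b, ∀ z ∈ geodesicHull (H.proj U a) (H.proj U b),
    ∃ t ∈ Icc 0 (len U), dist (φ U t) z ≤ R
  /-- the marked points `a_U` and `b_U` -/
  ma : H.Rel K a b → ℝ
  mb : H.Rel K a b → ℝ
  ma_mem : ∀ U, ma U ∈ Icc 0 (len U)
  mb_mem : ∀ U, mb U ∈ Icc 0 (len U)
  ma_close : ∀ U : H.Rel K a b, dist (φ U (ma U)) (H.proj U a) ≤ R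
  mb_close : ∀ U : H.Rel K a b, dist (φ U (mb U)) (H.proj U b) ≤ R
  δ : ∀ _V _U : H.Rel K a b, Set ℝ
  δmap : ∀ _V _U : H.Rel K a b, ℝ → Set ℝ
  δ_subset : ∀ V U : H.Rel K a b, (V < U ∨ H.Transverse (V : S) U) →
    δ V U ⊆ Icc 0 (len U) ∧ (δ V U).Nonempty
  δmap_subset : ∀ V U : H.Rel K a b, U < V → ∀ t ∈ Icc 0 (len V),
    δmap V U t ⊆ Icc 0 (len U) ∧ (δmap V U t).Nonempty
  δ_diam : ∀ V U : H.Rel K a b, (V < U ∨ H.Transverse (V : S) U) →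
    ∀ s ∈ δ V U, ∀ t ∈ δ V U, |s - t| ≤ R
  δ_rho : ∀ V U : H.Rel K a b, (V < U ∨ H.Transverse (V : S) U) →
    ∃ s ∈ δ V U, ∃ p ∈ H.rho (V : S) U, dist (φ U s) p ≤ R
  δ_marked : ∀ V U : H.Rel K a b, H.Transverse (V : S) U →
    ∃ s ∈ δ V U, |s - ma U| ≤ R ∨ |s - mb U| ≤ R
  δ_nested : ∀ U V W : H.Rel K a b, U < W → V < W → ¬ H.Transverse (U : S) V →
    ∀ s ∈ δ U W ∪ δ V W, ∀ t ∈ δ U W ∪ δ V W, |s - t| ≤ R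
  δ_transverse : ∀ U V W : H.Rel K a b, H.Transverse (U : S) V → W < V → ¬ H.orth (W : S) U →
    ∀ s ∈ δ V U ∪ δ W U, ∀ t ∈ δ V U ∪ δ W U, |s - t| ≤ R
  /-- bounded geodesic image, for two points `s ≤ t` in the same component of the complement of
  the `R`-neighbourhood of `δ^U_V` -/
  δmap_bgi : ∀ U V : H.Rel K a b, U < V → ∀ s ∈ Icc 0 (len V), ∀ t ∈ Icc 0 (len V), s ≤ t →
    (∀ m ∈ Icc s t, ∀ p ∈ δ U V, R < |m - p|) →
    ∀ x ∈ δmap V U s, ∀ y ∈ δmap V U t, |x - y| ≤ R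
  /-- away from `δ^U_V`, the map `δ^V_U` is coarsely the pull-back of `ρ^V_U` -/
  δmap_rho : ∀ U V : H.Rel K a b, U < V → ∀ t ∈ Icc 0 (len V), (∀ p ∈ δ U V, R < |t - p|) →
    ∀ x ∈ δmap V U t, dist (φ U x) (H.rhoMap (V : S) U (φ V t)) ≤ R

namespace IntervalSystem

variable {H : HHS X S C} {R K : ℝ} {a b : X}

/-- The intervals `T U = [0, len U]` with their relative projections. -/
def family (I : IntervalSystem H R K a b) : IntervalFamily (H.Rel K a b) where
  carrier U := Icc 0 (I.len U)
  pt := I.δ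
  map := I.δmap

/-- The union of the `r₁`-neighbourhoods in `T U` of the sets `δ^V_U` with `V ⊏ U` and of the two
marked points. -/
def nbhd (I : IntervalSystem H R K a b) (r₁ : ℝ) (U : H.Rel K a b) : Set ℝ :=
  Icc 0 (I.len U) ∩
    (Metric.cthickening r₁ {I.ma U} ∪ Metric.cthickening r₁ {I.mb U} ∪
      ⋃ V ∈ {V | V < U}, Metric.cthickening r₁ (I.δ V U))

/-- The cluster part of the `(r₁, r₂)`-thickening of `T U`: the `r₁`-neighbourhoods, together with
the segments joining any two of their points that are within `r₂` of each other. -/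
def clusters (I : IntervalSystem H R K a b) (r₁ r₂ : ℝ) (U : H.Rel K a b) : Set ℝ :=
  {t | ∃ x ∈ I.nbhd r₁ U, ∃ y ∈ I.nbhd r₁ U, x ≤ t ∧ t ≤ y ∧ y - x ≤ r₂}

/-- The map `q_U`, collapsing each cluster component to a point. -/
noncomputable def q (I : IntervalSystem H R K a b) (r₁ r₂ : ℝ) (U : H.Rel K a b) : ℝ → ℝ :=
  collapse (I.clusters r₁ r₂ U)

/-- The collapsed intervals with the collapsed relative projections. -/
noncomputable def collapsed (I : IntervalSystem H R K a b) (r₁ r₂ : ℝ) :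
    IntervalFamily (H.Rel K a b) :=
  I.family.push (I.q r₁ r₂)

/-- The edge part of the collapsed interval: the complement of the collapsed points. -/
noncomputable def edgePart (I : IntervalSystem H R K a b) (r₁ r₂ : ℝ) (U : H.Rel K a b) : Set ℝ :=
  (I.collapsed r₁ r₂).carrier U \ (I.q r₁ r₂ U '' I.clusters r₁ r₂ U)

/-- The components of the edge part of a collapsed interval. -/
def edgeComponents (I : IntervalSystem H R K a b) (r₁ r₂ : ℝ) (U : H.Rel K a b) : Set (Set ℝ) :=
  {e | ∃ x ∈ I.edgePart r₁ r₂ U, e = connectedComponentIn (I.edgePart r₁ r₂ U) x}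

/-- The `0`-consistent set `𝒬` of the collapsed intervals. -/
def Q (I : IntervalSystem H R K a b) (r₁ r₂ : ℝ) : Set (H.Rel K a b → ℝ) :=
  (I.collapsed r₁ r₂).zeroConsistent (fun U V => H.Transverse (U : S) V)

/-- A `B`-admissible trimming setup. The trimming intervals are compact; they may contain the
collapsed points that bound an edge component (collapsing a subinterval of an edge component
identifies its end points as well, so that nothing is lost by taking closures). -/
structure TrimmingSetup (I : IntervalSystem H R K a b) (r₁ r₂ B : ℝ) where
  intervals : H.Rel K a b → Set (Set ℝ)
  isInterval : ∀ U, ∀ D ∈ intervals U, ∃ s t : ℝ, s < t ∧ D = Icc s t ∧ t - s < B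
  subset_edge : ∀ U, ∀ D ∈ intervals U, ∃ e ∈ I.edgeComponents r₁ r₂ U, D ⊆ closure e
  card_le : ∀ U, ∀ e ∈ I.edgeComponents r₁ r₂ U,
    {D ∈ intervals U | D ⊆ closure e}.Finite ∧ ({D ∈ intervals U | D ⊆ closure e}.ncard : ℝ) ≤ B

namespace TrimmingSetup

variable {I : IntervalSystem H R K a b} {r₁ r₂ B : ℝ}

/-- The map `Δ_U` that collapses each trimming interval to a point. -/
noncomputable def collapseAt (D : I.TrimmingSetup r₁ r₂ B) (U : H.Rel K a b) : ℝ → ℝ :=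
  collapse (⋃₀ D.intervals U)

/-- The product map `Δ`. -/
noncomputable def Δ (D : I.TrimmingSetup r₁ r₂ B) (x : H.Rel K a b → ℝ) : H.Rel K a b → ℝ :=
  fun U => D.collapseAt U (x U)

/-- The trimmed intervals with the induced projections. -/
noncomputable def trimmed (D : I.TrimmingSetup r₁ r₂ B) : IntervalFamily (H.Rel K a b) :=
  (I.collapsed r₁ r₂).push D.collapseAt

/-- The `0`-consistent set `𝒬'` of the trimmed intervals. -/
def Q' (D : I.TrimmingSetup r₁ r₂ B) : Set (H.Rel K a b → ℝ) :=
  D.trimmed.zeroConsistent (fun U V => H.Transverse (U : S) V)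

end TrimmingSetup

end IntervalSystem

end

/-! Orient each collapsed interval from the end representing `a` to the end representing `b`. The
clusters are wider than every coarse constant in play, so coarse relations between projections
(consistency, bounded geodesic image, orthogonal domains projecting close together) become
equalities after collapsing. `IntervalSystem.oriented` records these equalities as an
`OrientedFamily`; what remains is order theory.

Put a wall `(U, z)` just above every point `z` of the `U`-interval except its top. A tuple `x`
crosses it when `z < x U`. Precedence is a strict partial order on walls (`prec_trans`), and only
walls of orthogonal domains can be incomparable. A tuple in the product of the intervals is
`0`-consistent exactly when the walls it crosses form a down-closed set (`lt_of_prec`,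
`mem_consistent_of_forall_prec`). In particular consistent tuples are closed under meets. To lift a
consistent tuple of the trimmed product, take least preimages in each coordinate and close the set
of crossed walls downwards; this never leaves the fibres of the trimming maps
(`OrientedFamily.exists_lift`).

Trimming is `1`-Lipschitz. For the reverse bound, passing to the meet reduces to tuples `x ≤ x'`. A
segment without nested projections in its interior lies in the closure of one edge component, so it
loses at most `B * B`; it remains to count such segments between `x` and `x'`. Their initial walls
contain a long chain, as antichains are bounded by the complexity. Each stretch of bounded length in
this chain completely crosses some minimal relevant domain, by the pigeonhole principle and the
bound on iterated orthogonal containers (`exists_between_of_pairwise_prec`). The interval of a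
minimal domain has no nested projections, so for `K` large against `B * B` it keeps length at least
`1` after trimming. Hence the trimmed distance bounds the number of segments linearly
(`card_le_of_consistent`). For `B < 1` there are no trimming intervals at all. -/

/-! ### Families of oriented intervals -/

/-- A combinatorial model of an interval system: oriented intervals `[lo U, hi U]` indexed by a set of
domains with nesting, transversality and orthogonality, and the points `d V U ∈ [lo U, hi U]`
to which a domain `V` that is nested in `U` or transverse to `U` projects. -/
structure OrientedFamily (ι : Type*) [PartialOrder ι] where
  trans : ι → ι → Prop
  orth : ι → ι → Prop
  lo : ι → ℝ
  hi : ι → ℝ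
  d : ι → ι → ℝ
  trans_symm : ∀ {U V}, trans U V → trans V U
  orth_symm : ∀ {U V}, orth U V → orth V U
  total : ∀ U V, U = V ∨ U < V ∨ V < U ∨ trans U V ∨ orth U V
  trans_not_le : ∀ {U V}, trans U V → ¬ U ≤ V
  trans_not_orth : ∀ {U V}, trans U V → ¬ orth U V
  orth_not_le : ∀ {U V}, orth U V → ¬ U ≤ V
  orth_of_le : ∀ {U V W}, V ≤ W → orth W U → orth V U
  lo_le_hi : ∀ U, lo U ≤ hi U
  d_mem : ∀ {V U}, (V < U ∨ trans V U) → d V U ∈ Icc (lo U) (hi U)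
  d_trans : ∀ {U V}, trans U V → lo U < hi U → lo V < hi V →
    (d V U = hi U ∧ d U V = lo V) ∨ (d V U = lo U ∧ d U V = hi V)
  d_nested : ∀ {U V W}, U < W → V < W → ¬ trans U V → d U W = d V W
  d_nested_trans : ∀ {U V W}, trans U V → W < V → ¬ orth W U → d V U = d W U
  d_orth : ∀ {U W V}, orth U W → (U < V ∨ trans U V) → (W < V ∨ trans W V) → d U V = d W V
  d_triple : ∀ {U V W}, trans V U → trans V W → trans U W → d V U = d W U ∨ d V W = d U W
  d_lt : ∀ {U V W}, U < V → W < V → trans U W → d U V < d W V → d W U = hi U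
  d_gt : ∀ {U V W}, U < V → W < V → trans U W → d W V < d U V → d W U = lo U

namespace OrientedFamily

variable {ι : Type*} [PartialOrder ι] (T : OrientedFamily ι)

/-- The walls `(U, z)`; such a wall lies immediately above the point `z` of `[lo U, hi U]`. -/
def IsWall (p : ι × ℝ) : Prop := T.lo p.1 ≤ p.2 ∧ p.2 < T.hi p.1

/-- A wall `p` precedes a wall `q` if every consistent path from `lo` to `hi` crosses `p` first. -/
def Prec (p q : ι × ℝ) : Prop :=
  (p.1 = q.1 ∧ p.2 < q.2) ∨
  (T.trans p.1 q.1 ∧ T.d q.1 p.1 = T.hi p.1 ∧ T.d p.1 q.1 = T.lo q.1) ∨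
  (p.1 < q.1 ∧ T.d p.1 q.1 ≤ q.2) ∨
  (q.1 < p.1 ∧ p.2 < T.d q.1 p.1)

variable {T}

theorem trans_not_ge {U V : ι} (h : T.trans U V) : ¬ V ≤ U := T.trans_not_le (T.trans_symm h)

theorem trans_ne {U V : ι} (h : T.trans U V) : U ≠ V := fun e => T.trans_not_le h e.le

theorem orth_of_le_right {U V W : ι} (h : V ≤ W) (h' : T.orth U W) : T.orth U V :=
  T.orth_symm (T.orth_of_le h (T.orth_symm h'))

theorem IsWall.lt {p : ι × ℝ} (h : T.IsWall p) : T.lo p.1 < T.hi p.1 := h.1.trans_lt h.2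

theorem prec_irrefl (p : ι × ℝ) : ¬ T.Prec p p := by
  rintro (h | h | h | h)
  · exact lt_irrefl _ h.2
  · exact trans_ne h.1 rfl
  · exact lt_irrefl _ h.1
  · exact lt_irrefl _ h.1

theorem prec_of_trans_of_eq_hi {p q : ι × ℝ} (hp : T.IsWall p) (hq : T.IsWall q)
    (h : T.trans p.1 q.1) (h' : T.d q.1 p.1 = T.hi p.1) : T.Prec p q := by
  rcases T.d_trans h hp.lt hq.lt with h1 | h1
  · exact Or.inr (Or.inl ⟨h, h1⟩)
  · exact absurd (h1.1.symm.trans h') hp.lt.ne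

theorem prec_of_trans_of_eq_lo {p q : ι × ℝ} (hp : T.IsWall p) (hq : T.IsWall q)
    (h : T.trans p.1 q.1) (h' : T.d p.1 q.1 = T.lo q.1) : T.Prec p q := by
  rcases T.d_trans h hp.lt hq.lt with h1 | h1
  · exact Or.inr (Or.inl ⟨h, h1⟩)
  · exact absurd (h'.symm.trans h1.2) hq.lt.ne

theorem prec_of_lt {p q : ι × ℝ} (h : p.1 < q.1) (h' : T.d p.1 q.1 ≤ q.2) : T.Prec p q :=
  Or.inr (Or.inr (Or.inl ⟨h, h'⟩))

theorem prec_of_gt {p q : ι × ℝ} (h : q.1 < p.1) (h' : p.2 < T.d q.1 p.1) : T.Prec p q :=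
  Or.inr (Or.inr (Or.inr ⟨h, h'⟩))

theorem prec_of_trans_of_lt {p q : ι × ℝ} (hp : T.IsWall p) (hq : T.IsWall q)
    (h : T.trans p.1 q.1) (h' : T.lo p.1 < T.d q.1 p.1) : T.Prec p q := by
  rcases T.d_trans h hp.lt hq.lt with h1 | h1
  · exact Or.inr (Or.inl ⟨h, h1⟩)
  · exact absurd h1.1 h'.ne'

/-- For nested domains, the position of the larger domain's wall relative to the projection decides;
for transverse ones `d_trans` does. Hence an antichain of walls has pairwise orthogonal domains. -/
theorem prec_comparable {p q : ι × ℝ} (hp : T.IsWall p) (hq : T.IsWall q) (ho : ¬ T.orth p.1 q.1) :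
    p = q ∨ T.Prec p q ∨ T.Prec q p := by
  rcases T.total p.1 q.1 with h | h | h | h | h
  · rcases lt_trichotomy p.2 q.2 with h' | h' | h'
    · exact Or.inr (Or.inl (Or.inl ⟨h, h'⟩))
    · exact Or.inl (Prod.ext h h')
    · exact Or.inr (Or.inr (Or.inl ⟨h.symm, h'⟩))
  · rcases le_or_gt (T.d p.1 q.1) q.2 with h' | h'
    · exact Or.inr (Or.inl (prec_of_lt h h'))
    · exact Or.inr (Or.inr (prec_of_gt h h'))
  · rcases le_or_gt (T.d q.1 p.1) p.2 with h' | h'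
    · exact Or.inr (Or.inr (prec_of_lt h h'))
    · exact Or.inr (Or.inl (prec_of_gt h h'))
  · rcases T.d_trans h hp.lt hq.lt with h1 | h1
    · exact Or.inr (Or.inl (Or.inr (Or.inl ⟨h, h1⟩)))
    · exact Or.inr (Or.inr (Or.inr (Or.inl ⟨T.trans_symm h, h1.symm⟩)))
  · exact absurd h ho

/-- The relation of `p.1` to `r.1` is not given, so all cases are examined. The bad ones contradict
the hypotheses on nesting and orthogonality, or force two projections to `q.1` on different sides of
`q` to coincide; the others transport a known projection to the pair `p.1`, `r.1`. -/
theorem prec_trans_of_trans {p q r : ι × ℝ} (hp : T.IsWall p) (hq : T.IsWall q) (hr : T.IsWall r)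
    (h : T.trans p.1 q.1) (h1 : T.d q.1 p.1 = T.hi p.1) (h2 : T.d p.1 q.1 = T.lo q.1)
    (hqr : T.Prec q r) : T.Prec p r := by
  rcases hqr with ⟨e, _⟩ | ⟨k, k1, k2⟩ | ⟨k, k1⟩ | ⟨k, k1⟩
  · refine Or.inr (Or.inl ⟨e ▸ h, ?_, ?_⟩)
    · rw [← e, h1]
    · rw [← e, h2]
  · rcases T.total p.1 r.1 with e | e | e | e | e
    · rw [← e, h2] at k1; exact absurd k1 hq.lt.ne
    · have := T.d_nested_trans k e (fun o => T.trans_not_orth h o)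
      rw [h2, k1] at this; exact absurd this hq.lt.ne'
    · have := T.d_nested_trans (T.trans_symm h) e
        (fun o => T.trans_not_orth k (T.orth_symm o))
      rw [h2, k1] at this; exact absurd this hq.lt.ne
    · rcases T.d_triple (T.trans_symm h) k e with i | i
      · exact prec_of_trans_of_eq_hi hp hr e (i ▸ h1)
      · exact prec_of_trans_of_eq_lo hp hr e (i ▸ k2)
    · have := T.d_orth e (Or.inr h) (Or.inr (T.trans_symm k))
      rw [h2, k1] at this; exact absurd this hq.lt.ne
  · rcases T.total p.1 r.1 with e | e | e | e | e
    · exact absurd (e ▸ k.le) (trans_not_ge h)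
    · refine prec_of_lt e ?_
      by_contra! hlt
      have := T.d_lt k e (T.trans_symm h) (k1.trans_lt hlt)
      rw [h2] at this; exact absurd this hq.lt.ne
    · exact absurd (k.trans e).le (trans_not_ge h)
    · have := T.d_nested_trans e k (fun o => T.trans_not_orth h (T.orth_symm o))
      exact prec_of_trans_of_eq_hi hp hr e (this.trans h1)
    · exact absurd (orth_of_le_right k.le e) (T.trans_not_orth h)
  · rcases T.total p.1 r.1 with e | e | e | e | e
    · exact absurd (e ▸ k.le) (T.trans_not_le h)
    · exact absurd (e.trans k).le (T.trans_not_le h)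
    · refine prec_of_gt e ?_
      have := T.d_nested_trans h k (T.orth_not_le · e.le)
      rw [← this, h1]; exact hp.2
    · have := T.d_nested_trans h k (fun o => T.trans_not_orth e (T.orth_symm o))
      exact prec_of_trans_of_eq_hi hp hr e (this ▸ h1)
    · have := T.d_orth e (Or.inr h) (Or.inl k)
      rw [← this, h2] at k1; exact absurd k1 hq.1.not_gt

theorem prec_trans_of_lt {p q r : ι × ℝ} (hp : T.IsWall p) (hq : T.IsWall q) (hr : T.IsWall r)
    (h : p.1 < q.1) (h1 : T.d p.1 q.1 ≤ q.2)
    (hqr : T.Prec q r) : T.Prec p r := by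
  rcases hqr with ⟨e, e'⟩ | ⟨k, k1, k2⟩ | ⟨k, k1⟩ | ⟨k, k1⟩
  · refine prec_of_lt (e ▸ h) ?_
    rw [← e]; exact h1.trans e'.le
  · rcases T.total p.1 r.1 with e | e | e | e | e
    · exact absurd (e ▸ h.le) (trans_not_ge k)
    · refine prec_of_lt e ?_
      rw [← T.d_nested_trans (T.trans_symm k) h (T.orth_not_le · e.le), k2]; exact hr.1
    · exact absurd (e.trans h).le (trans_not_ge k)
    · have := T.d_nested_trans (T.trans_symm k) h (T.trans_not_orth e)
      exact prec_of_trans_of_eq_lo hp hr e (this ▸ k2)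
    · have := T.d_orth e (Or.inl h) (Or.inr (T.trans_symm k))
      rw [this, k1] at h1; exact absurd hq.2 h1.not_gt
  · refine prec_of_lt (h.trans k) ?_
    rw [T.d_nested (h.trans k) k (fun t => T.trans_not_le t h.le)]; exact k1
  -- Domains nested in `q.1` that are not transverse project to the same point, so distinct
  -- projections force transversality and `d_lt` orders the two.
  · have hlt := h1.trans_lt k1
    have e : T.trans p.1 r.1 := by
      by_contra e
      exact hlt.ne (T.d_nested h k e)
    exact prec_of_trans_of_eq_hi hp hr e (T.d_lt h k e hlt)

theorem prec_trans_of_gt {p q r : ι × ℝ} (hp : T.IsWall p) (hq : T.IsWall q) (hr : T.IsWall r)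
    (h : q.1 < p.1) (h1 : p.2 < T.d q.1 p.1)
    (hqr : T.Prec q r) : T.Prec p r := by
  rcases hqr with ⟨e, e'⟩ | ⟨k, k1, k2⟩ | ⟨k, k1⟩ | ⟨k, k1⟩
  · refine prec_of_gt (e ▸ h) ?_
    rw [← e]; exact h1
  · rcases T.total p.1 r.1 with e | e | e | e | e
    · exact absurd (e ▸ h.le) (T.trans_not_le k)
    · exact absurd (h.trans e).le (T.trans_not_le k)
    · refine prec_of_gt e ?_
      by_contra! hle
      have := T.d_gt h e k (hle.trans_lt h1)
      rw [k1] at this; exact absurd this hq.lt.ne'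
    · have := T.d_nested_trans (T.trans_symm e) h (T.trans_not_orth k)
      exact prec_of_trans_of_eq_lo hp hr e (this.trans k2)
    · exact absurd (T.orth_of_le h.le e) (T.trans_not_orth k)
  · rcases T.total p.1 r.1 with e | e | e | e | e
    · refine Or.inl ⟨e, ?_⟩
      rw [← e] at k1; exact h1.trans_le k1
    · refine prec_of_lt e ?_
      rw [← T.d_nested k e (fun t => T.trans_not_le t h.le)]; exact k1
    · refine prec_of_gt e ?_
      rw [← T.d_nested h e (fun t => T.trans_not_le t k.le)]; exact h1
    · have := T.d_nested_trans e k (T.orth_not_le · h.le)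
      exact prec_of_trans_of_lt hp hr e (this ▸ hp.1.trans_lt h1)
    · exact absurd k.le (T.orth_not_le (T.orth_of_le h.le e))
  · refine prec_of_gt (k.trans h) ?_
    rw [T.d_nested (k.trans h) h (fun t => T.trans_not_le t k.le)]; exact h1

theorem prec_trans {p q r : ι × ℝ} (hp : T.IsWall p) (hq : T.IsWall q) (hr : T.IsWall r)
    (hpq : T.Prec p q) (hqr : T.Prec q r) : T.Prec p r := by
  rcases hpq with ⟨e, e'⟩ | ⟨h, h1, h2⟩ | ⟨h, h1⟩ | ⟨h, h1⟩
  · rcases hqr with ⟨k, k'⟩ | ⟨k, k1, k2⟩ | ⟨k, k1⟩ | ⟨k, k1⟩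
    · exact Or.inl ⟨e.trans k, e'.trans k'⟩
    · exact Or.inr (Or.inl ⟨e ▸ k, e ▸ k1, e ▸ k2⟩)
    · exact prec_of_lt (e ▸ k) (e ▸ k1)
    · exact prec_of_gt (e ▸ k) (e ▸ e'.trans k1)
  · exact prec_trans_of_trans hp hq hr h h1 h2 hqr
  · exact prec_trans_of_lt hp hq hr h h1 hqr
  · exact prec_trans_of_gt hp hq hr h h1 hqr

/-! ### Consistent tuples -/

variable (T) in
/-- The `0`-consistent tuples of the family obtained by applying the monotone map `f U` in each
coordinate. -/
def consistent (f : ι → ℝ → ℝ) : Set (ι → ℝ) :=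
  {x | (∀ U, x U ∈ Icc (f U (T.lo U)) (f U (T.hi U))) ∧
    (∀ U V, T.trans U V → x U = f U (T.d V U) ∨ x V = f V (T.d U V)) ∧
    ∀ U V, U < V → x V = f V (T.d U V) ∨ (x V < f V (T.d U V) ∧ x U = f U (T.lo U)) ∨
      (f V (T.d U V) < x V ∧ x U = f U (T.hi U))}

/-- The walls below the image of a consistent tuple form a down-closed set. -/
theorem le_of_prec {f : ι → ℝ → ℝ} (hf : ∀ U, Monotone (f U)) {y : ι → ℝ}
    (hy : y ∈ T.consistent f) {p q : ι × ℝ} (hp : T.IsWall p) (hq : T.IsWall q)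
    (hpq : T.Prec p q) (hqy : f q.1 q.2 < y q.1) : f p.1 p.2 ≤ y p.1 := by
  have hlo : f q.1 (T.lo q.1) < y q.1 := (hf _ hq.1).trans_lt hqy
  rcases hpq with ⟨e, e'⟩ | ⟨h, h1, h2⟩ | ⟨h, h1⟩ | ⟨h, h1⟩
  · rw [← e] at hqy; exact (hf _ e'.le).trans hqy.le
  · rcases hy.2.1 _ _ h with k | k
    · rw [k, h1]; exact hf _ hp.2.le
    · rw [k, h2] at hlo; exact absurd hlo (lt_irrefl _)
  · have := (hf _ h1).trans_lt hqy
    rcases hy.2.2 _ _ h with k | k | k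
    · exact absurd k this.ne'
    · exact absurd k.1 this.not_gt
    · rw [k.2]; exact hf _ hp.2.le
  · have := hf p.1 h1.le
    rcases hy.2.2 _ _ h with k | k | k
    · rw [k]; exact this
    · exact absurd k.2 hlo.ne'
    · exact this.trans k.1.le

/-- By density of the reals, precedence leaves room above `p` once `q` is raised. This turns the
weak inequalities of `le_of_prec` and of suprema into strict ones. -/
theorem prec_lift {p q : ι × ℝ} (hp : T.IsWall p) (hq : T.IsWall q) (hpq : T.Prec p q)
    {w : ℝ} (hw : q.2 < w) :
    ∃ u, p.2 < u ∧ u < T.hi p.1 ∧ T.Prec (p.1, u) (q.1, w) := by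
  rcases hpq with ⟨e, e'⟩ | ⟨h, h1, h2⟩ | ⟨h, h1⟩ | ⟨h, h1⟩
  · exact ⟨q.2, e', e ▸ hq.2, Or.inl ⟨e, hw⟩⟩
  · obtain ⟨u, hu, hu'⟩ := exists_between hp.2
    exact ⟨u, hu, hu', Or.inr (Or.inl ⟨h, h1, h2⟩)⟩
  · obtain ⟨u, hu, hu'⟩ := exists_between hp.2
    exact ⟨u, hu, hu', prec_of_lt h (h1.trans hw.le)⟩
  · obtain ⟨u, hu, hu'⟩ := exists_between h1
    exact ⟨u, hu, hu'.trans_le (T.d_mem (Or.inl h)).2, prec_of_gt h hu'⟩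

theorem lt_of_prec {x : ι → ℝ} (hx : x ∈ T.consistent fun _ => id) {p q : ι × ℝ}
    (hp : T.IsWall p) (hq : T.IsWall q) (hpq : T.Prec p q) (hqx : q.2 < x q.1) : p.2 < x p.1 := by
  obtain ⟨w, hw, hw'⟩ := exists_between hqx
  have hwhi : w < T.hi q.1 := hw'.trans_le (hx.1 q.1).2
  obtain ⟨u, hu, hu', h⟩ := prec_lift hp hq hpq hw
  exact hu.trans_le (le_of_prec (fun _ => monotone_id) hx (p := (p.1, u)) (q := (q.1, w))
    ⟨hp.1.trans hu.le, hu'⟩ ⟨hq.1.trans hw.le, hwhi⟩ h hw')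

/-- A tuple whose walls form a down-closed set is consistent. -/
theorem mem_consistent_of_forall_prec {x : ι → ℝ} (hx : ∀ U, x U ∈ Icc (T.lo U) (T.hi U))
    (h : ∀ p q, T.IsWall p → T.IsWall q → T.Prec p q → q.2 < x q.1 → p.2 < x p.1) :
    x ∈ T.consistent fun _ => id := by
  have key : ∀ U V, T.trans U V → T.d V U = T.hi U → T.d U V = T.lo V → x U = T.hi U ∨
      x V = T.lo V := by
    intro U V hUV h1 h2
    by_contra! hne
    have hU : x U < T.hi U := lt_of_le_of_ne (hx U).2 hne.1
    have hV : T.lo V < x V := lt_of_le_of_ne (hx V).1 (Ne.symm hne.2)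
    -- The wall at `lo V` is crossed, whereas the wall just above `x U`, which precedes it, is not.
    have := h (U, x U) (V, T.lo V) ⟨(hx U).1, hU⟩ ⟨le_rfl, hV.trans_le (hx V).2⟩
      (Or.inr (Or.inl ⟨hUV, h1, h2⟩)) hV
    exact lt_irrefl _ this
  refine ⟨hx, fun U V hUV => ?_, fun U V hUV => ?_⟩
  · have hd1 := T.d_mem (Or.inr hUV)
    have hd2 := T.d_mem (Or.inr (T.trans_symm hUV))
    rcases (T.lo_le_hi U).lt_or_eq with hU | hU
    · rcases (T.lo_le_hi V).lt_or_eq with hV | hV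
      · rcases T.d_trans hUV hU hV with ⟨h1, h2⟩ | ⟨h1, h2⟩
        · rw [h1, h2]; exact key U V hUV h1 h2
        · rw [h1, h2]; exact (key V U (T.trans_symm hUV) h2 h1).symm
      · right
        have := hx V
        rw [← hV, Icc_self, mem_singleton_iff] at hd1 this
        rw [hd1, this]; rfl
    · left
      have := hx U
      rw [← hU, Icc_self, mem_singleton_iff] at hd2 this
      rw [hd2, this]; rfl
  · have hd := T.d_mem (Or.inl hUV)
    rcases lt_trichotomy (x V) (T.d U V) with hlt | heq | hgt
    · refine Or.inr (Or.inl ⟨hlt, ?_⟩)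
      by_contra hne
      have hU : T.lo U < x U := lt_of_le_of_ne (hx U).1 (Ne.symm hne)
      exact lt_irrefl _ (h (V, x V) (U, T.lo U) ⟨(hx V).1, hlt.trans_le hd.2⟩
        ⟨le_rfl, hU.trans_le (hx U).2⟩ (prec_of_gt hUV hlt) hU)
    · exact Or.inl heq
    · refine Or.inr (Or.inr ⟨hgt, ?_⟩)
      by_contra hne
      have hU : x U < T.hi U := lt_of_le_of_ne (hx U).2 hne
      exact lt_irrefl _ (h (U, x U) (V, T.d U V) ⟨(hx U).1, hU⟩
        ⟨hd.1, hgt.trans_le (hx V).2⟩ (prec_of_lt hUV le_rfl) hgt)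

/-- A monotone map either keeps a strict inequality or collapses it, and in the latter case the
tuple lands on the projection point. -/
theorem map_mem_consistent {f : ι → ℝ → ℝ} (hf : ∀ U, Monotone (f U)) {x : ι → ℝ}
    (hx : x ∈ T.consistent fun _ => id) : (fun U => f U (x U)) ∈ T.consistent f := by
  refine ⟨fun U => ⟨hf U (hx.1 U).1, hf U (hx.1 U).2⟩, fun U V h => ?_, fun U V h => ?_⟩
  · exact (hx.2.1 U V h).imp (congrArg _) (congrArg _)
  · rcases hx.2.2 U V h with h1 | ⟨h1, h2⟩ | ⟨h1, h2⟩
    · exact Or.inl (congrArg _ h1)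
    · rcases (hf V h1.le).lt_or_eq with h3 | h3
      · exact Or.inr (Or.inl ⟨h3, congrArg _ h2⟩)
      · exact Or.inl h3
    · rcases (hf V h1.le).lt_or_eq with h3 | h3
      · exact Or.inr (Or.inr ⟨h3, congrArg _ h2⟩)
      · exact Or.inl h3.symm

/-- Down-closed sets of walls are stable under intersection. -/
theorem inf_mem_consistent {x x' : ι → ℝ} (hx : x ∈ T.consistent fun _ => id)
    (hx' : x' ∈ T.consistent fun _ => id) : x ⊓ x' ∈ T.consistent fun _ => id :=
  mem_consistent_of_forall_prec
    (fun U => ⟨le_inf (hx.1 U).1 (hx'.1 U).1, inf_le_left.trans (hx.1 U).2⟩)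
    fun _ _ hp hq hpq h => lt_inf_iff.2
      ⟨lt_of_prec hx hp hq hpq (lt_inf_iff.1 h).1, lt_of_prec hx' hp hq hpq (lt_inf_iff.1 h).2⟩

/-- Every consistent tuple of the image family is the image of a consistent tuple. -/
theorem exists_lift {f : ι → ℝ → ℝ} (hf : ∀ U, Monotone (f U)) (hc : ∀ U, Continuous (f U))
    {y : ι → ℝ} (hy : y ∈ T.consistent f) :
    ∃ x ∈ T.consistent fun _ => id, (fun U => f U (x U)) = y := by
  -- Least preimages: below `l U` the value stays strictly below `y U`, which is the strictness that
  -- `le_of_prec` requires.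
  have hl : ∀ U, ∃ l ∈ Icc (T.lo U) (T.hi U), f U l = y U ∧ ∀ t, T.lo U ≤ t → t < l →
      f U t < y U := by
    intro U
    obtain ⟨t, ht, hty⟩ := intermediate_value_Icc (T.lo_le_hi U) (hc U).continuousOn (hy.1 U)
    have hcomp : IsCompact (Icc (T.lo U) (T.hi U) ∩ f U ⁻¹' {y U}) :=
      isCompact_Icc.inter_right (isClosed_singleton.preimage (hc U))
    obtain ⟨l, hl, hmin⟩ := hcomp.exists_isLeast ⟨t, ht, hty⟩
    refine ⟨l, hl.1, hl.2, fun s hs hsl => lt_of_le_of_ne ((hf U hsl.le).trans_eq hl.2) ?_⟩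
    exact fun e => hsl.not_ge (hmin ⟨⟨hs, hsl.le.trans hl.1.2⟩, e⟩)
  choose l hl hly hlt using hl
  -- The tuple `l` need not be consistent; `A` is the downward closure of the set of walls it
  -- crosses.
  let A : ι → Set ℝ := fun U => {u | T.IsWall (U, u) ∧
    ∃ q, T.IsWall q ∧ q.2 < l q.1 ∧ ((U, u) = q ∨ T.Prec (U, u) q)}
  have hAhi : ∀ U, ∀ u ∈ insert (l U) (A U), u ≤ T.hi U := by
    rintro U u (rfl | hu)
    · exact (hl U).2
    · exact hu.1.2.le
  have hbdd : ∀ U, BddAbove (insert (l U) (A U)) := fun U => ⟨_, hAhi U⟩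
  have hfle : ∀ U, ∀ u ∈ insert (l U) (A U), f U u ≤ y U := by
    rintro U u (rfl | ⟨hu, q, hq, hql, rfl | hp⟩)
    · exact (hly U).le
    · exact (hlt _ _ hq.1 hql).le
    · exact le_of_prec hf hy hu hq hp (hlt _ _ hq.1 hql)
  set x : ι → ℝ := fun U => sSup (insert (l U) (A U)) with hxdef
  have hlx : ∀ U, l U ≤ x U := fun U => le_csSup (hbdd U) (mem_insert _ _)
  have hxA : ∀ U, ∀ u ∈ A U, u ≤ x U := fun U u hu => le_csSup (hbdd U) (mem_insert_of_mem _ hu)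
  refine ⟨x, ?_, funext fun U => le_antisymm ?_ ?_⟩
  · refine mem_consistent_of_forall_prec
      (fun U => ⟨(hl U).1.trans (hlx U), csSup_le (insert_nonempty _ _) (hAhi U)⟩) ?_
    intro p q hp hq hpq hqx
    -- Move up to a wall of `A` strictly above `q`; raising `p` accordingly keeps the inequality
    -- strict in the supremum.
    obtain ⟨w, hw, hqw⟩ := exists_lt_of_lt_csSup (insert_nonempty _ _) hqx
    obtain ⟨w', hw', hqw'⟩ : ∃ w' ∈ A q.1, q.2 < w' := by
      rcases hw with rfl | hw
      · obtain ⟨w', h1, h2⟩ := exists_between hqw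
        have : T.IsWall (q.1, w') := ⟨hq.1.trans h1.le, h2.trans_le (hl _).2⟩
        exact ⟨w', ⟨this, _, this, h2, Or.inl rfl⟩, h1⟩
      · exact ⟨w, hw, hqw⟩
    obtain ⟨u, hu, hu', h⟩ := prec_lift hp hq hpq hqw'
    have huw : T.IsWall (p.1, u) := ⟨hp.1.trans hu.le, hu'⟩
    obtain ⟨hw1, r, hr, hrl, e | hr'⟩ := hw'
    · exact hu.trans_le (hxA _ _ ⟨huw, r, hr, hrl, Or.inr (e ▸ h)⟩)
    · exact hu.trans_le (hxA _ _ ⟨huw, r, hr, hrl, Or.inr (prec_trans huw hw1 hr h hr')⟩)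
  · have hcl : IsClosed {t | f U t ≤ y U} := isClosed_le (hc U) continuous_const
    exact closure_minimal (hfle U) hcl (csSup_mem_closure (insert_nonempty _ _) (hbdd U))
  · exact (hly U).ge.trans (hf U (hlx U))

end OrientedFamily

/-! ### Long chains of walls cross minimal domains -/

/-- A finite set all of whose antichains have at most `c` elements contains a chain which is as
long as the pigeonhole principle predicts. -/
theorem exists_chain_of_antichain_card_le {α : Type*} {r : α → α → Prop} {c : ℕ} (s : Finset α)
    (hirr : ∀ p ∈ s, ¬ r p p)
    (htr : ∀ p ∈ s, ∀ q ∈ s, ∀ t ∈ s, r p q → r q t → r p t)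
    (hanti : ∀ t ⊆ s, (∀ p ∈ t, ∀ q ∈ t, ¬ r p q) → t.card ≤ c) :
    ∃ l : List α, l.Pairwise r ∧ (∀ p ∈ l, p ∈ s) ∧ s.card ≤ c * l.length := by
  classical
  induction s using Finset.strongInduction with
  | H s ih =>
    rcases s.eq_empty_or_nonempty with rfl | hne
    · exact ⟨[], List.Pairwise.nil, by simp, by simp⟩
    -- Peel off the layer of minimal elements, which is an antichain. A chain in the rest starts at
    -- a non-minimal element, so it extends downwards by one.
    let m : Finset α := s.filter fun p => ∀ q ∈ s, ¬ r q p
    have hms : m ⊆ s := Finset.filter_subset _ _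
    have hmc : m.card ≤ c := hanti m hms fun p hp q hq =>
      (Finset.mem_filter.1 hq).2 p (hms hp)
    have hmne : m.Nonempty := by
      obtain ⟨p, hp, hmin⟩ := s.exists_min_image (fun p => (s.filter fun q => r q p).card) hne
      refine ⟨p, Finset.mem_filter.2 ⟨hp, fun q hq hqp => (hmin q hq).not_gt ?_⟩⟩
      refine Finset.card_lt_card ⟨fun t ht => ?_, fun h => ?_⟩
      · rw [Finset.mem_filter] at ht ⊢
        exact ⟨ht.1, htr t ht.1 q hq p hp ht.2 hqp⟩
      · exact hirr q hq (Finset.mem_filter.1 (h (Finset.mem_filter.2 ⟨hq, hqp⟩))).2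
    have hsub : s \ m ⊂ s := Finset.sdiff_ssubset hms hmne
    obtain ⟨l, hl, hls, hlc⟩ := ih (s \ m) hsub (fun p hp => hirr p (hsub.1 hp))
      (fun p hp q hq t ht => htr p (hsub.1 hp) q (hsub.1 hq) t (hsub.1 ht))
      (fun t ht => hanti t (ht.trans hsub.1))
    have hcard : s.card ≤ c * (l.length + 1) := by
      have := Finset.card_sdiff_add_card_eq_card hms
      rw [mul_add, mul_one]; omega
    cases l with
    | nil =>
      obtain ⟨p, hp⟩ := hne
      exact ⟨[p], List.pairwise_singleton _ _, by simpa using hp, hcard⟩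
    | cons p l =>
      have hp := Finset.mem_sdiff.1 (hls p List.mem_cons_self)
      obtain ⟨q, hq, hqp⟩ : ∃ q ∈ s, r q p := by
        by_contra! h
        exact hp.2 (Finset.mem_filter.2 ⟨hp.1, h⟩)
      have hls' : ∀ t ∈ p :: l, t ∈ s := fun t ht => hsub.1 (hls t ht)
      refine ⟨q :: p :: l, List.pairwise_cons.2 ⟨fun t ht => ?_, hl⟩, ?_, hcard⟩
      · rcases List.mem_cons.1 ht with rfl | ht'
        · exact hqp
        · exact htr q hq p hp.1 t (hls' t ht) hqp ((List.pairwise_cons.1 hl).1 t ht')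
      · intro t ht
        rcases List.mem_cons.1 ht with rfl | ht'
        · exact hq
        · exact hls' t ht'

namespace OrientedFamily

variable {ι : Type*} [PartialOrder ι] {T : OrientedFamily ι}

variable (T) in
/-- All walls of `U` lie between the walls `p` and `q`. -/
def Between (p : ι × ℝ) (U : ι) (q : ι × ℝ) : Prop :=
  T.Prec p (U, T.lo U) ∧ ∀ u, T.IsWall (U, u) → T.Prec (U, u) q

variable (T) in
/-- A bound `n` on the complexity of the index set: there is a strictly monotone rank with values
less than `n`, and there are at most `n` domains `V i` such that `V j` is orthogonal to a
domain `U i ≤ V i` for all `j > i`. -/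
structure ComplexityLE (n : ℕ) : Prop where
  exists_rank : ∃ rank : ι → ℕ, StrictMono rank ∧ ∀ U, rank U < n
  descent : ∀ (m : ℕ) (V U : Fin m → ι), (∀ i, U i ≤ V i) →
    (∀ i j, i < j → T.orth (U i) (V j)) → m ≤ n

/-- Past `p`, the projection of `U` is still ahead, so `U` is crossed after `p`. Not being
orthogonal to `q.1`, it projects there where `p.1` does, to the lower end, so it is crossed before
`q`. -/
theorem between_of_not_orth_of_lt {p q : ι × ℝ} {U : ι}
    (hq : T.IsWall q) (ht : T.trans p.1 q.1) (hpq : T.d p.1 q.1 = T.lo q.1)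
    (hUp : U < p.1) (hlt : p.2 < T.d U p.1) (ho : ¬ T.orth U q.1) : T.Between p U q := by
  have hd := T.d_nested_trans (T.trans_symm ht) hUp ho
  refine ⟨prec_of_gt hUp hlt, fun u hu => ?_⟩
  rcases T.total U q.1 with e | e | e | e | e
  · exact absurd (e ▸ hUp.le) (trans_not_ge ht)
  · exact prec_of_lt e (by rw [← hd, hpq]; exact hq.1)
  · exact absurd (e.trans hUp).le (trans_not_ge ht)
  · exact prec_of_trans_of_eq_lo hu hq e (hd.symm.trans hpq)
  · exact absurd e ho

/-- The mirror image: `U` is behind `q` in `q.1`, and projects to the upper end of `p.1`. -/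
theorem between_of_not_orth_of_le {p q : ι × ℝ} {U : ι} (hU : T.lo U < T.hi U)
    (hp : T.IsWall p) (ht : T.trans p.1 q.1) (hpq : T.d q.1 p.1 = T.hi p.1)
    (hUq : U < q.1) (hle : T.d U q.1 ≤ q.2) (ho : ¬ T.orth U p.1) : T.Between p U q := by
  have hd := T.d_nested_trans ht hUq ho
  refine ⟨?_, fun _ _ => prec_of_lt hUq hle⟩
  rcases T.total U p.1 with e | e | e | e | e
  · exact absurd (e ▸ hUq.le) (T.trans_not_le ht)
  · exact prec_of_gt e (by rw [← hd, hpq]; exact hp.2)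
  · exact absurd (e.trans hUq).le (T.trans_not_le ht)
  · exact prec_of_trans_of_eq_hi hp ⟨le_rfl, hU⟩ (T.trans_symm e) (hd.symm.trans hpq)
  · exact absurd e ho

/-- Along a sufficiently long chain of walls some minimal domain is crossed completely. -/
theorem exists_between_of_pairwise_prec {n : ℕ} (hn : T.ComplexityLE n)
    (hmin : ∀ U : ι, ∃ U' ≤ U, IsMin U') (hnd : ∀ U, IsMin U → T.lo U < T.hi U)
    {l : List (ι × ℝ)} (hl : l.Pairwise T.Prec) (hw : ∀ p ∈ l, T.IsWall p)
    (hd : ∀ p ∈ l, ∀ q ∈ l, p.1 = q.1 → p.2 < q.2 → ∃ V, V < q.1 ∧ T.d V q.1 = q.2)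
    (hlen : n * 3 * (n + 2) < l.length) :
    ∃ p ∈ l, ∃ q ∈ l, ∃ U, IsMin U ∧ T.Between p U q := by
  classical
  by_contra! hcon
  obtain ⟨rank, hrank, hrn⟩ := hn.exists_rank
  choose g hg hgmin using hmin
  -- The type of a wall: its domain is minimal, or a chosen minimal domain nested in it is still
  -- ahead, or that domain is already behind. With `n` ranks and three types, more than `n + 2`
  -- walls agree in both.
  let ty : ι × ℝ → Fin 3 := fun p =>
    if IsMin p.1 then 0 else if p.2 < T.d (g p.1) p.1 then 1 else 2
  obtain ⟨⟨k, c⟩, hk⟩ := Fintype.exists_lt_card_fiber_of_mul_lt_card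
    (f := fun i : Fin l.length => ((⟨rank (l.get i).1, hrn _⟩, ty (l.get i)) : Fin n × Fin 3))
    (n := n + 2) (by simpa using hlen)
  set s := Finset.univ.filter fun i : Fin l.length =>
    ((⟨rank (l.get i).1, hrn _⟩, ty (l.get i)) : Fin n × Fin 3) = (k, c) with hs
  let e := s.orderEmbOfFin rfl
  have hmem : ∀ i, l.get (e i) ∈ l := fun i => l.get_mem _
  have hes : ∀ i, rank (l.get (e i)).1 = k ∧ ty (l.get (e i)) = c := by
    intro i
    have := (Finset.mem_filter.1 (s.orderEmbOfFin_mem rfl i)).2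
    rw [Prod.mk.injEq] at this
    exact ⟨congrArg Fin.val this.1, this.2⟩
  have hprec : ∀ i j, i < j → T.Prec (l.get (e i)) (l.get (e j)) := fun i j hij =>
    List.pairwise_iff_get.1 hl _ _ (e.strictMono hij)
  have htrans : ∀ i j, i < j → T.trans (l.get (e i)).1 (l.get (e j)).1 ∧
      T.d (l.get (e j)).1 (l.get (e i)).1 = T.hi (l.get (e i)).1 ∧
      T.d (l.get (e i)).1 (l.get (e j)).1 = T.lo (l.get (e j)).1 := by
    intro i j hij
    -- Equal ranks exclude nesting. Two walls of one domain enclose a minimal domain below the `V`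
    -- that projects to the later wall. Only transversality remains.
    have hr : rank (l.get (e i)).1 = rank (l.get (e j)).1 := (hes i).1.trans (hes j).1.symm
    rcases hprec i j hij with ⟨h1, h2⟩ | h | h | h
    · obtain ⟨V, hV, hVd⟩ := hd _ (hmem i) _ (hmem j) h1 h2
      have hgd : T.d (g V) (l.get (e j)).1 = T.d V (l.get (e j)).1 :=
        T.d_nested ((hg V).trans_lt hV) hV (fun t => T.trans_not_le t (hg V))
      refine absurd ⟨prec_of_gt ?_ ?_, fun _ _ => prec_of_lt ?_ ?_⟩
        (hcon _ (hmem i) _ (hmem j) (g V) (hgmin V))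
      · rw [h1]; exact (hg V).trans_lt hV
      · rw [h1, hgd, hVd]; exact h2
      · exact (hg V).trans_lt hV
      · rw [hgd, hVd]
    · exact h
    · exact absurd hr (hrank h.1).ne
    · exact absurd hr (hrank h.1).ne'
  have hcl : ∀ i : Fin s.card, g (l.get (e i)).1 ≤ (l.get (e i)).1 := fun i => hg _
  have hlt : ∀ i, ¬ IsMin (l.get (e i)).1 → g (l.get (e i)).1 < (l.get (e i)).1 := fun i hi =>
    lt_of_le_of_ne (hg _) fun h => hi (h ▸ hgmin (l.get (e i)).1)
  have hscard : n + 2 < s.card := hk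
  have hty : ∀ i, ty (l.get (e i)) = c := fun i => (hes i).2
  have hcard : ¬ s.card ≤ n := by omega
  match c, hty with
  | 0, hty =>
    have hm : ∀ i, IsMin (l.get (e i)).1 := by
      intro i
      have := hty i
      by_contra h
      simp only [ty, h, if_false] at this
      split_ifs at this <;> exact absurd this (by decide)
    -- Of three consecutive transverse minimal domains, the middle one is crossed between the outer
    -- walls.
    have h0 : (⟨0, by omega⟩ : Fin s.card) < ⟨1, by omega⟩ := by simp
    have h1 : (⟨1, by omega⟩ : Fin s.card) < ⟨2, by omega⟩ := by simp
    exact hcon _ (hmem _) _ (hmem _) _ (hm ⟨1, by omega⟩)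
      ⟨Or.inr (Or.inl (htrans _ _ h0)), fun u _ => Or.inr (Or.inl (htrans _ _ h1))⟩
  | 1, hty =>
    -- If none of the nested minimal domains is crossed, each is orthogonal to all later domains,
    -- and there are too many of them for `descent`.
    refine hcard (hn.descent _ (fun i => (l.get (e i)).1) (fun i => g (l.get (e i)).1) hcl ?_)
    intro i j hij
    have hi : ¬ IsMin (l.get (e i)).1 ∧ (l.get (e i)).2 < T.d (g (l.get (e i)).1) (l.get (e i)).1 := by
      have := hty i
      simp only [ty] at this
      split_ifs at this with h1 h2
      exacts [absurd this (by decide), ⟨h1, h2⟩, absurd this (by decide)]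
    by_contra ho
    exact hcon _ (hmem _) _ (hmem _) _ (hgmin _) (between_of_not_orth_of_lt
      (hw _ (hmem j)) (htrans i j hij).1 (htrans i j hij).2.2 (hlt i hi.1) hi.2 ho)
  | 2, hty =>
    -- Here each nested minimal domain is orthogonal to all earlier domains, so the order is
    -- reversed.
    refine hcard (hn.descent _ (fun i => (l.get (e i.rev)).1) (fun i => g (l.get (e i.rev)).1)
      (fun i => hcl i.rev) ?_)
    intro i j hij
    have hij' : j.rev < i.rev := Fin.rev_lt_rev.2 hij
    have hi : ¬ IsMin (l.get (e i.rev)).1 ∧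
        T.d (g (l.get (e i.rev)).1) (l.get (e i.rev)).1 ≤ (l.get (e i.rev)).2 := by
      have := hty i.rev
      simp only [ty] at this
      split_ifs at this with h1 h2
      exacts [absurd this (by decide), absurd this (by decide), ⟨h1, not_lt.1 h2⟩]
    by_contra ho
    exact hcon _ (hmem _) _ (hmem _) _ (hgmin _) (between_of_not_orth_of_le (hnd _ (hgmin _))
      (hw _ (hmem j.rev)) (htrans _ _ hij').1 (htrans _ _ hij').2.1 (hlt _ hi.1) hi.2 ho)

/-- Disjoint blocks of a chain of walls completely cross distinct minimal domains. -/
theorem exists_finset_between_of_pairwise_prec {n : ℕ} (hn : T.ComplexityLE n)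
    (hmin : ∀ U : ι, ∃ U' ≤ U, IsMin U') (hnd : ∀ U, IsMin U → T.lo U < T.hi U) (k : ℕ)
    {l : List (ι × ℝ)} (hl : l.Pairwise T.Prec) (hw : ∀ p ∈ l, T.IsWall p)
    (hd : ∀ p ∈ l, ∀ q ∈ l, p.1 = q.1 → p.2 < q.2 → ∃ V, V < q.1 ∧ T.d V q.1 = q.2)
    (hlen : (n * 3 * (n + 2) + 1) * k ≤ l.length) :
    ∃ s : Finset ι, s.card = k ∧ ∀ U ∈ s, IsMin U ∧ ∃ p ∈ l, ∃ q ∈ l, T.Between p U q := by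
  classical
  induction k generalizing l with
  | zero => exact ⟨∅, rfl, by simp⟩
  | succ k ih =>
    set M := n * 3 * (n + 2) + 1 with hM
    have hlM : M * k + M ≤ l.length := by rw [← Nat.mul_succ]; exact hlen
    have htake : ∀ p ∈ l.take M, p ∈ l := fun p hp => List.mem_of_mem_take hp
    have hdrop : ∀ p ∈ l.drop M, p ∈ l := fun p hp => List.mem_of_mem_drop hp
    have hl' := hl
    rw [← List.take_append_drop M l, List.pairwise_append] at hl'
    obtain ⟨s, hs, hsU⟩ := ih hl'.2.1 (fun p hp => hw p (hdrop p hp))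
      (fun p hp q hq => hd p (hdrop p hp) q (hdrop q hq)) (by rw [List.length_drop]; omega)
    obtain ⟨p, hp, q, hq, U, hU, hpq⟩ := exists_between_of_pairwise_prec hn hmin hnd hl'.1
      (fun p hp => hw p (htake p hp)) (fun p hp q hq => hd p (htake p hp) q (htake q hq))
      (by rw [List.length_take]; omega)
    -- A domain crossed within the first block and again within a later one would give a cycle of
    -- precedences.
    have hUs : U ∉ s := by
      intro h
      obtain ⟨-, p', hp', q', -, hb⟩ := hsU U h
      have hwU : T.IsWall (U, T.lo U) := ⟨le_rfl, hnd U hU⟩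
      exact prec_irrefl (T := T) _ (prec_trans hwU (hw q (htake q hq)) hwU (hpq.2 _ hwU)
        (prec_trans (hw q (htake q hq)) (hw p' (hdrop p' hp')) hwU (hl'.2.2 q hq p' hp') hb.1))
    refine ⟨insert U s, by rw [Finset.card_insert_of_notMem hUs, hs], fun V hV => ?_⟩
    rcases Finset.mem_insert.1 hV with rfl | hV
    · exact ⟨hU, p, htake p hp, q, htake q hq, hpq⟩
    · obtain ⟨h1, p', hp', q', hq', hb⟩ := hsU V hV
      exact ⟨h1, p', hdrop p' hp', q', hdrop q' hq', hb⟩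

end OrientedFamily

/-! ### Coarse expansion of the image map -/

/-- Interior breakpoints cut the segment into one more piece than their number, and each piece costs
at most `C`. -/
theorem sub_le_mul_card_of_forall {G : ℝ → ℝ} {C a b : ℝ} (Z : Finset ℝ)
    (hG : ∀ s t, a ≤ s → s ≤ t → t ≤ b → (∀ z ∈ Z, z ∉ Ioo s t) → G t - G s ≤ C)
    {s t : ℝ} (has : a ≤ s) (hst : s ≤ t) (htb : t ≤ b) :
    G t - G s ≤ C * ((Z.filter fun z => s < z ∧ z < t).card + 1) := by
  classical
  induction h : (Z.filter fun z => s < z ∧ z < t).card using Nat.strong_induction_on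
    generalizing s t with
  | _ m ih =>
    rcases (Z.filter fun z => s < z ∧ z < t).eq_empty_or_nonempty with he | ⟨z, hz⟩
    · rw [he, Finset.card_empty] at h
      rw [← h]
      simpa using hG s t has hst htb fun z hz hz' =>
        Finset.notMem_empty z (he ▸ Finset.mem_filter.2 ⟨hz, hz'⟩)
    · obtain ⟨hzZ, hsz, hzt⟩ := Finset.mem_filter.1 hz
      have hdisj : Disjoint (Z.filter fun y => s < y ∧ y < z) (Z.filter fun y => z < y ∧ y < t) :=
        Finset.disjoint_left.2 fun y hy hy' =>
          ((Finset.mem_filter.1 hy).2.2.trans (Finset.mem_filter.1 hy').2.1).false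
      have hsub : (Z.filter fun y => s < y ∧ y < z) ∪ (Z.filter fun y => z < y ∧ y < t) ⊆
          (Z.filter fun y => s < y ∧ y < t).erase z := by
        intro y hy
        rcases Finset.mem_union.1 hy with hy | hy <;> obtain ⟨h1, h2, h3⟩ := Finset.mem_filter.1 hy
        · exact Finset.mem_erase.2 ⟨h3.ne, Finset.mem_filter.2 ⟨h1, h2, h3.trans hzt⟩⟩
        · exact Finset.mem_erase.2 ⟨h2.ne', Finset.mem_filter.2 ⟨h1, hsz.trans h2, h3⟩⟩
      have hc := Finset.card_le_card hsub
      rw [Finset.card_union_of_disjoint hdisj, Finset.card_erase_of_mem hz, h] at hc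
      have hm : 0 < m := h ▸ Finset.card_pos.2 ⟨z, hz⟩
      have h1 := ih _ (by omega) has hsz.le (hzt.le.trans htb) rfl
      have h2 := ih _ (by omega) (has.trans hsz.le) hzt.le htb rfl
      have h0 : 0 ≤ C := by simpa using hG s s has le_rfl (hst.trans htb) (by simp)
      have hc' : (((Z.filter fun y => s < y ∧ y < z).card : ℝ) +
          (Z.filter fun y => z < y ∧ y < t).card + 1) ≤ m := by exact_mod_cast (by omega)
      calc G t - G s = (G z - G s) + (G t - G z) := by ring
        _ ≤ _ := add_le_add h1 h2
        _ = C * (((Z.filter fun y => s < y ∧ y < z).card : ℝ) +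
          (Z.filter fun y => z < y ∧ y < t).card + 1 + 1) := by ring
        _ ≤ C * (m + 1) := by gcongr

namespace OrientedFamily

variable {ι : Type*} [PartialOrder ι] {T : OrientedFamily ι}

/-- A pairwise orthogonal family of domains is bounded by the complexity. -/
theorem card_le_of_forall_not_prec {n : ℕ} (hn : T.ComplexityLE n) (s : Finset (ι × ℝ))
    (hw : ∀ p ∈ s, T.IsWall p) (h : ∀ p ∈ s, ∀ q ∈ s, ¬ T.Prec p q) : s.card ≤ n := by
  refine hn.descent s.card (fun i => (s.equivFin.symm i).1.1) _ (fun i => le_rfl) ?_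
  intro i j hij
  by_contra ho
  rcases prec_comparable (hw _ (s.equivFin.symm i).2) (hw _ (s.equivFin.symm j).2) ho with k | k | k
  · exact hij.ne (s.equivFin.symm.injective (Subtype.ext k))
  · exact h _ (s.equivFin.symm i).2 _ (s.equivFin.symm j).2 k
  · exact h _ (s.equivFin.symm j).2 _ (s.equivFin.symm i).2 k

/-- The walls that separate two comparable consistent tuples and lie immediately above the first
tuple or above a projection of a nested domain are linearly bounded in number by the distance of
the images, provided every minimal domain has large image. -/
theorem card_le_of_consistent [Fintype ι] {n : ℕ} (hn : T.ComplexityLE n) {f : ι → ℝ → ℝ}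
    (hf : ∀ U, Monotone (f U))
    (hlarge : ∀ U, IsMin U → T.lo U < T.hi U ∧ 1 ≤ f U (T.hi U) - f U (T.lo U))
    {x x' : ι → ℝ} (hx : x ∈ T.consistent fun _ => id) (hx' : x' ∈ T.consistent fun _ => id)
    (hle : x ≤ x') (s : Finset (ι × ℝ)) (hs : ∀ p ∈ s, x p.1 ≤ p.2 ∧ p.2 < x' p.1)
    (hsd : ∀ p ∈ s, p.2 = x p.1 ∨ ∃ V, V < p.1 ∧ T.d V p.1 = p.2) :
    (s.card : ℝ) ≤ n * ((n * 3 * (n + 2) + 1) * (∑ U, (f U (x' U) - f U (x U)) + 1)) := by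
  classical
  have hw : ∀ p ∈ s, T.IsWall p := fun p hp =>
    ⟨(hx.1 p.1).1.trans (hs p hp).1, (hs p hp).2.trans_le (hx'.1 p.1).2⟩
  obtain ⟨l, hl, hls, hcard⟩ := exists_chain_of_antichain_card_le (r := T.Prec) (c := n) s
    (fun p _ => prec_irrefl p)
    (fun p hp q hq t ht => prec_trans (hw p hp) (hw q hq) (hw t ht))
    (fun t ht => card_le_of_forall_not_prec hn t (fun p hp => hw p (ht hp)))
  set M := n * 3 * (n + 2) + 1 with hM
  have hmin : ∀ U : ι, ∃ U' ≤ U, IsMin U' := by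
    intro U
    obtain ⟨U', h1, h2⟩ := (Set.toFinite (Iic U)).exists_le_minimal (mem_Iic.2 le_rfl)
    exact ⟨U', h1, fun V hV => h2.2 (hV.trans h1) hV⟩
  obtain ⟨S, hS, hSU⟩ := exists_finset_between_of_pairwise_prec hn hmin
    (fun U hU => (hlarge U hU).1) (l.length / M) hl (fun p hp => hw p (hls p hp))
    -- The later of two walls of one domain is strictly above `x`, so it lies at a nested
    -- projection.
    (fun p hp q hq e hlt => (hsd q (hls q hq)).resolve_left fun h => by
      have := (hs p (hls p hp)).1
      rw [h, ← e] at hlt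
      exact hlt.not_ge this)
    (Nat.mul_div_le _ _)
  have hfx : ∀ U, 0 ≤ f U (x' U) - f U (x U) := fun U => sub_nonneg.2 (hf U (hle U))
  have hsum : ((l.length / M : ℕ) : ℝ) ≤ ∑ U, (f U (x' U) - f U (x U)) := by
    calc ((l.length / M : ℕ) : ℝ) = ∑ U ∈ S, (1 : ℝ) := by simp [hS]
      _ ≤ ∑ U ∈ S, (f U (x' U) - f U (x U)) := ?_
      _ ≤ _ := Finset.sum_le_sum_of_subset_of_nonneg (Finset.subset_univ _) fun U _ _ => hfx U
    refine Finset.sum_le_sum fun U hU => ?_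
    obtain ⟨hU', p, hp, q, hq, h1, h2⟩ := hSU U hU
    have hlt := (hlarge U hU').1
    -- All walls of `U` lie between `p`, not crossed by `x`, and `q`, crossed by `x'`. Hence `x` is
    -- at the bottom of `U` and `x'` at the top, and `U` contributes at least `1`.
    have hxlo : x U = T.lo U := by
      by_contra hne
      have := lt_of_prec hx (hw p (hls p hp)) (q := (U, T.lo U)) ⟨le_rfl, hlt⟩ h1
        (lt_of_le_of_ne (hx.1 U).1 (Ne.symm hne))
      exact this.not_ge (hs p (hls p hp)).1
    have hxhi : x' U = T.hi U := by
      by_contra hne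
      have hwU : T.IsWall (U, x' U) := ⟨(hx'.1 U).1, lt_of_le_of_ne (hx'.1 U).2 hne⟩
      exact lt_irrefl _ (lt_of_prec hx' hwU (hw q (hls q hq)) (h2 _ hwU) (hs q (hls q hq)).2)
    rw [hxlo, hxhi]
    exact (hlarge U hU').2
  have hlen : (l.length : ℝ) ≤ M * ((l.length / M : ℕ) + 1) := by
    have := Nat.lt_mul_div_succ l.length (show 0 < M by omega)
    exact_mod_cast this.le
  have hMr : ((M : ℕ) : ℝ) = n * 3 * (n + 2) + 1 := by rw [hM]; push_cast; ring
  rw [← hMr]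
  calc (s.card : ℝ) ≤ n * l.length := by exact_mod_cast hcard
    _ ≤ n * (M * ((l.length / M : ℕ) + 1)) := by gcongr
    _ ≤ _ := by gcongr

/-- Cut each `[x U, x' U]` at the nested projections. Each piece loses at most `c`, and the lower
ends of the pieces are the walls counted in `card_le_of_consistent`. -/
theorem sum_sub_le_of_consistent [Fintype ι] {n : ℕ} (hn : T.ComplexityLE n) {f : ι → ℝ → ℝ}
    (hf : ∀ U, Monotone (f U)) {c : ℝ} (hc : 0 ≤ c)
    (hloss : ∀ U s t, T.lo U ≤ s → s ≤ t → t ≤ T.hi U → (∀ V, V < U → T.d V U ∉ Ioo s t) →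
      t - s ≤ f U t - f U s + c)
    (hlarge : ∀ U, IsMin U → T.lo U < T.hi U ∧ 1 ≤ f U (T.hi U) - f U (T.lo U))
    {x x' : ι → ℝ} (hx : x ∈ T.consistent fun _ => id) (hx' : x' ∈ T.consistent fun _ => id)
    (hle : x ≤ x') :
    ∑ U, (x' U - x U) ≤ ∑ U, (f U (x' U) - f U (x U)) +
      c * (n * ((n * 3 * (n + 2) + 1) * (∑ U, (f U (x' U) - f U (x U)) + 1))) := by
  classical
  let Z : ι → Finset ℝ := fun U => (Finset.univ.filter (· < U)).image fun V => T.d V U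
  have hZ : ∀ U z, z ∈ Z U ↔ ∃ V, V < U ∧ T.d V U = z := by simp [Z]
  let P : ι → Finset ℝ := fun U => insert (x U) ((Z U).filter fun z => x U < z ∧ z < x' U)
  let F : Finset ι := Finset.univ.filter fun U => x U < x' U
  let s : Finset (ι × ℝ) := F.biUnion fun U => (P U).image fun z => (U, z)
  have hPcard : ∀ U, (P U).card = ((Z U).filter fun z => x U < z ∧ z < x' U).card + 1 :=
    fun U => Finset.card_insert_of_notMem (by simp)
  have hscard : s.card = ∑ U ∈ F, (P U).card := by
    rw [Finset.card_biUnion]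
    · exact Finset.sum_congr rfl fun U _ =>
        Finset.card_image_of_injective _ fun _ _ h => (Prod.mk.inj h).2
    · intro U _ V _ hUV
      refine Finset.disjoint_left.2 fun p hp hp' => hUV ?_
      obtain ⟨z, -, rfl⟩ := Finset.mem_image.1 hp
      obtain ⟨z', -, h⟩ := Finset.mem_image.1 hp'
      exact (Prod.mk.inj h).1.symm
  have hmem : ∀ p ∈ s, x p.1 < x' p.1 ∧ p.2 ∈ P p.1 := by
    intro p hp
    obtain ⟨U, hU, hp⟩ := Finset.mem_biUnion.1 hp
    obtain ⟨z, hz, rfl⟩ := Finset.mem_image.1 hp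
    exact ⟨(Finset.mem_filter.1 hU).2, hz⟩
  have hs := card_le_of_consistent hn hf hlarge hx hx' hle s
    (fun p hp => by
      obtain ⟨h1, h2⟩ := hmem p hp
      rcases Finset.mem_insert.1 h2 with h | h
      · exact ⟨h.ge, h ▸ h1⟩
      · exact ⟨(Finset.mem_filter.1 h).2.1.le, (Finset.mem_filter.1 h).2.2⟩)
    (fun p hp => by
      rcases Finset.mem_insert.1 (hmem p hp).2 with h | h
      · exact Or.inl h
      · exact Or.inr ((hZ _ _).1 (Finset.mem_filter.1 h).1))
  have hU : ∀ U ∈ F, (x' U - x U) - (f U (x' U) - f U (x U)) ≤ c * ((P U).card : ℝ) := by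
    intro U _
    have := sub_le_mul_card_of_forall (G := fun t => t - f U t) (C := c) (a := T.lo U)
      (b := T.hi U) (Z U) (fun s t h1 h2 h3 h4 => by
        have := hloss U s t h1 h2 h3 fun V hV => h4 _ ((hZ _ _).2 ⟨V, hV, rfl⟩)
        linarith) (hx.1 U).1 (hle U) (hx'.1 U).2
    rw [hPcard]
    push_cast
    linarith
  have hF : ∑ U, ((x' U - x U) - (f U (x' U) - f U (x U))) ≤ c * s.card := by
    rw [← Finset.sum_subset (Finset.subset_univ F)]
    · rw [hscard]
      push_cast
      rw [Finset.mul_sum]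
      exact Finset.sum_le_sum hU
    · intro U _ hUF
      have : x U = x' U := (hle U).antisymm (not_lt.1 fun h => hUF (by simp [F, h]))
      simp [this]
  rw [Finset.sum_sub_distrib] at hF
  have := mul_le_mul_of_nonneg_left hs hc
  linarith

/-- The coordinatewise image map is coarsely expanding on the consistent tuples. -/
theorem sum_abs_sub_le_of_consistent [Fintype ι] {n : ℕ} (hn : T.ComplexityLE n) {f : ι → ℝ → ℝ}
    (hf : ∀ U, Monotone (f U)) {c : ℝ} (hc : 0 ≤ c)
    (hloss : ∀ U s t, T.lo U ≤ s → s ≤ t → t ≤ T.hi U → (∀ V, V < U → T.d V U ∉ Ioo s t) →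
      t - s ≤ f U t - f U s + c)
    (hlarge : ∀ U, IsMin U → T.lo U < T.hi U ∧ 1 ≤ f U (T.hi U) - f U (T.lo U))
    {x x' : ι → ℝ} (hx : x ∈ T.consistent fun _ => id) (hx' : x' ∈ T.consistent fun _ => id) :
    ∑ U, |x U - x' U| ≤ (1 + 2 * (c * (n * (n * 3 * (n + 2) + 1)))) *
      (∑ U, |f U (x U) - f U (x' U)| + 1) := by
  -- In each coordinate the meet equals one of the two tuples, so both `ℓ¹` sums split through it.
  have hinf := inf_mem_consistent hx hx'
  have h1 := sum_sub_le_of_consistent hn hf hc hloss hlarge hinf hx inf_le_left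
  have h2 := sum_sub_le_of_consistent hn hf hc hloss hlarge hinf hx' inf_le_right
  have e1 : ∑ U, (x U - (x ⊓ x') U) + ∑ U, (x' U - (x ⊓ x') U) = ∑ U, |x U - x' U| := by
    rw [← Finset.sum_add_distrib]
    refine Finset.sum_congr rfl fun U _ => ?_
    rw [Pi.inf_apply]
    rcases le_total (x U) (x' U) with h | h
    · rw [inf_eq_left.2 h, abs_of_nonpos (by linarith)]; ring
    · rw [inf_eq_right.2 h, abs_of_nonneg (by linarith)]; ring
  have e2 : ∑ U, (f U (x U) - f U ((x ⊓ x') U)) + ∑ U, (f U (x' U) - f U ((x ⊓ x') U)) =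
      ∑ U, |f U (x U) - f U (x' U)| := by
    rw [← Finset.sum_add_distrib]
    refine Finset.sum_congr rfl fun U _ => ?_
    rw [Pi.inf_apply]
    rcases le_total (x U) (x' U) with h | h
    · rw [inf_eq_left.2 h, abs_of_nonpos (by linarith [hf U h])]; ring
    · rw [inf_eq_right.2 h, abs_of_nonneg (by linarith [hf U h])]; ring
  set k : ℝ := c * (n * (n * 3 * (n + 2) + 1)) with hk
  have hk0 : 0 ≤ k := by positivity
  have h3 : 0 ≤ ∑ U, |f U (x U) - f U (x' U)| := by positivity
  rw [← e1, ← e2] at *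
  set a := ∑ U, (f U (x U) - f U ((x ⊓ x') U))
  set b := ∑ U, (f U (x' U) - f U ((x ⊓ x') U))
  have h1' : ∑ U, (x U - (x ⊓ x') U) ≤ a + k * (a + 1) := by rw [hk]; linarith
  have h2' : ∑ U, (x' U - (x ⊓ x') U) ≤ b + k * (b + 1) := by rw [hk]; linarith
  nlinarith [mul_nonneg hk0 h3]

end OrientedFamily

/-! ### The collapsing map -/

theorem volume_Icc_diff_ne_top (A : Set ℝ) (s t : ℝ) : volume (Icc s t \ A) ≠ ⊤ :=
  ((measure_mono sdiff_subset).trans_lt measure_Icc_lt_top).ne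

theorem volume_Ioc_diff_ne_top (A : Set ℝ) (s t : ℝ) : volume (Ioc s t \ A) ≠ ⊤ :=
  ((measure_mono sdiff_subset).trans_lt measure_Ioc_lt_top).ne

theorem collapse_mono (A : Set ℝ) : Monotone (collapse A) := fun _ _ h =>
  ENNReal.toReal_mono (volume_Icc_diff_ne_top _ _ _)
    (measure_mono (sdiff_subset_sdiff_left (Icc_subset_Icc_right h)))

theorem collapse_of_nonpos (A : Set ℝ) {t : ℝ} (h : t ≤ 0) : collapse A t = 0 := by
  have : volume (Icc 0 t \ A) = 0 :=
    measure_mono_null (sdiff_subset.trans (Icc_subset_Icc_right h)) (by simp)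
  rw [collapse, this, ENNReal.toReal_zero]

/-- The cut is along the measurable half-line up to `s`, so `A` can be arbitrary. -/
theorem collapse_sub {A : Set ℝ} {s t : ℝ} (hs : 0 ≤ s) (hst : s ≤ t) :
    collapse A t - collapse A s = (volume (Ioc s t \ A)).toReal := by
  have h := measure_inter_add_sdiff (μ := volume) (Icc 0 t \ A) (measurableSet_Iic (a := s))
  have h1 : Icc 0 t \ A ∩ Iic s = Icc 0 s \ A := by
    ext z; simp only [mem_inter_iff, Set.mem_sdiff, mem_Icc, mem_Iic]
    exact ⟨fun h => ⟨⟨h.1.1.1, h.2⟩, h.1.2⟩, fun h => ⟨⟨⟨h.1.1, h.1.2.trans hst⟩, h.2⟩, h.1.2⟩⟩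
  have h2 : (Icc 0 t \ A) \ Iic s = Ioc s t \ A := by
    ext z; simp only [Set.mem_sdiff, mem_Icc, mem_Iic, mem_Ioc, not_le]
    exact ⟨fun h => ⟨⟨h.2, h.1.1.2⟩, h.1.2⟩, fun h => ⟨⟨⟨hs.trans h.1.1.le, h.1.2⟩, h.2⟩, h.1.1⟩⟩
  rw [h1, h2] at h
  rw [collapse, collapse, ← h, ENNReal.toReal_add (volume_Icc_diff_ne_top _ _ _)
    (volume_Ioc_diff_ne_top _ _ _), add_sub_cancel_left]

theorem collapse_sub_le (A : Set ℝ) {s t : ℝ} (hst : s ≤ t) :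
    collapse A t - collapse A s ≤ t - s := by
  rcases le_total 0 s with hs | hs
  · rw [collapse_sub hs hst]
    refine (ENNReal.toReal_mono measure_Ioc_lt_top.ne (measure_mono sdiff_subset)).trans_eq ?_
    rw [Real.volume_Ioc, ENNReal.toReal_ofReal (sub_nonneg.2 hst)]
  · rw [collapse_of_nonpos A hs, sub_zero]
    rcases le_total t 0 with ht | ht
    · rw [collapse_of_nonpos A ht]; linarith
    · refine (ENNReal.toReal_mono measure_Icc_lt_top.ne (measure_mono sdiff_subset)).trans ?_
      rw [Real.volume_Icc, ENNReal.toReal_ofReal (by linarith)]; linarith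

theorem abs_collapse_sub_le (A : Set ℝ) (s t : ℝ) : |collapse A s - collapse A t| ≤ |s - t| := by
  rcases le_total s t with h | h
  · rw [abs_sub_comm, abs_of_nonneg (sub_nonneg.2 (collapse_mono A h)), abs_sub_comm,
      abs_of_nonneg (sub_nonneg.2 h)]
    exact collapse_sub_le A h
  · rw [abs_of_nonneg (sub_nonneg.2 (collapse_mono A h)), abs_of_nonneg (sub_nonneg.2 h)]
    exact collapse_sub_le A h

theorem continuous_collapse (A : Set ℝ) : Continuous (collapse A) :=
  (LipschitzWith.of_dist_le_mul (K := 1) fun s t => by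
    simpa [Real.dist_eq] using abs_collapse_sub_le A s t).continuous

theorem collapse_eq_of_Icc_subset {A : Set ℝ} {s t : ℝ} (hs : 0 ≤ s) (hst : s ≤ t)
    (h : Icc s t ⊆ A) : collapse A s = collapse A t := by
  have := collapse_sub (A := A) hs hst
  rw [sdiff_eq_empty.2 (Ioc_subset_Icc_self.trans h), measure_empty, ENNReal.toReal_zero] at this
  linarith

theorem collapse_eq_of_uIcc_subset {A : Set ℝ} {s t : ℝ} (hs : 0 ≤ s) (ht : 0 ≤ t)
    (h : uIcc s t ⊆ A) : collapse A s = collapse A t := by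
  rcases le_total s t with hst | hst
  · exact collapse_eq_of_Icc_subset hs hst (uIcc_of_le hst ▸ h)
  · exact (collapse_eq_of_Icc_subset ht hst (uIcc_of_ge hst ▸ h)).symm

/-- Subadditivity of outer measure suffices: the part removed from the open segment is covered by
`F`. -/
theorem sub_le_collapse_sub_add {A : Set ℝ} {s t B : ℝ} (hs : 0 ≤ s) (hst : s ≤ t) (hB : 0 ≤ B)
    (F : Finset (Set ℝ)) (hF : ∀ D ∈ F, volume D ≤ ENNReal.ofReal B)
    (hA : A ∩ Ioo s t ⊆ ⋃ D ∈ F, D) :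
    t - s ≤ collapse A t - collapse A s + F.card * B := by
  rw [collapse_sub hs hst]
  have h1 : Ioo s t ⊆ (Ioc s t \ A) ∪ ⋃ D ∈ F, D := by
    intro z hz
    by_cases hzA : z ∈ A
    · exact Or.inr (hA ⟨hzA, hz⟩)
    · exact Or.inl ⟨Ioo_subset_Ioc_self hz, hzA⟩
  have h2 : volume (⋃ D ∈ F, D) ≤ ENNReal.ofReal (F.card * B) := by
    refine (measure_biUnion_finset_le F fun D => D).trans ((Finset.sum_le_sum hF).trans ?_)
    rw [Finset.sum_const, nsmul_eq_mul, ENNReal.ofReal_mul (Nat.cast_nonneg _),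
      ENNReal.ofReal_natCast]
  have h3 := (measure_mono h1).trans ((measure_union_le (μ := volume) _ _).trans
    (add_le_add le_rfl h2))
  rw [Real.volume_Ioo] at h3
  have h4 := ENNReal.toReal_mono (by finiteness [volume_Ioc_diff_ne_top A s t]) h3
  rwa [ENNReal.toReal_ofReal (sub_nonneg.2 hst), ENNReal.toReal_add
    (volume_Ioc_diff_ne_top A s t) ENNReal.ofReal_ne_top, ENNReal.toReal_ofReal (by positivity)]
    at h4

theorem collapse_of_disjoint {A : Set ℝ} {s t : ℝ} (hs : 0 ≤ s) (hst : s ≤ t)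
    (hA : Disjoint A (Ioo s t)) : collapse A t - collapse A s = t - s :=
  (collapse_sub_le A hst).antisymm (by
    simpa using sub_le_collapse_sub_add hs hst le_rfl ∅ (by simp) (by simp [hA.inter_eq]))

/-! ### Hierarchically hyperbolic spaces -/

namespace HHS

variable {X : Type u} [MetricSpace X] {S : Type v} [PartialOrder S]
  {C : S → Type w} [∀ U, MetricSpace (C U)] (H : HHS X S C)

/-- The rank is the order-theoretic height, bounded because chains are. -/
theorem exists_rank : ∃ rank : S → ℕ, StrictMono rank ∧ ∀ U, rank U < H.complexity := by
  classical
  have hlen : ∀ p : LTSeries S, p.length < H.complexity := by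
    intro p
    have := H.chain_bound (Finset.univ.image p) (by
      intro U hU V hV
      obtain ⟨i, -, rfl⟩ := Finset.mem_image.1 hU
      obtain ⟨j, -, rfl⟩ := Finset.mem_image.1 hV
      exact (le_total i j).imp (fun h => p.monotone h) (fun h => p.monotone h))
    rw [Finset.card_image_of_injective _ p.strictMono.injective, Finset.card_univ,
      Fintype.card_fin] at this
    omega
  have hlt : ∀ U : S, Order.height U < H.complexity := by
    intro U
    by_contra! h
    obtain ⟨p, -, hp⟩ := Order.exists_series_of_le_height U h
    exact (hlen p).ne hp
  choose r hr using fun U => ENat.ne_top_iff_exists.1 (hlt U).ne_top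
  refine ⟨r, fun U V h => ?_, fun U => ?_⟩
  · have := Order.height_strictMono h ((hlt U).trans_le le_top)
    rw [← hr, ← hr] at this
    exact_mod_cast this
  · have := hlt U
    rw [← hr] at this
    exact_mod_cast this

theorem transverse_symm {U V : S} (h : H.Transverse U V) : H.Transverse V U :=
  ⟨h.2.1, h.1, fun o => h.2.2 (H.orth_symm _ _ o)⟩

theorem total (U V : S) : U = V ∨ U < V ∨ V < U ∨ H.Transverse U V ∨ H.orth U V := by
  by_cases h1 : U ≤ V
  · exact h1.eq_or_lt.imp_right Or.inl
  · by_cases h2 : V ≤ U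
    · exact Or.inr (Or.inr (Or.inl (lt_of_le_not_ge h2 h1)))
    · by_cases h3 : H.orth U V
      · exact Or.inr (Or.inr (Or.inr (Or.inr h3)))
      · exact Or.inr (Or.inr (Or.inr (Or.inl ⟨h1, h2, h3⟩)))

/-- If `V j` is orthogonal to some `U i ≤ V i` for all `i < j`, then iterated orthogonal
containers form a chain. -/
theorem exists_chain_of_orth {m : ℕ} (V U : Fin m → S) (hUV : ∀ i, U i ≤ V i)
    (ho : ∀ i j, i < j → H.orth (U i) (V j)) (T : S) (hT : ∀ i, V i ≤ T) (hm : 0 < m) :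
    ∃ F : Finset S, F.card = m ∧ (∀ W ∈ F, W ≤ T) ∧ ∀ W ∈ F, ∀ W' ∈ F, W ≤ W' ∨ W' ≤ W := by
  classical
  induction m generalizing T with
  | zero => omega
  | succ m ih =>
    rcases Nat.eq_zero_or_pos m with rfl | hm'
    · exact ⟨{T}, by simp⟩
    obtain ⟨W, hW, hVW⟩ := H.orth_container T (U 0) ((hUV 0).trans (hT 0))
      ⟨V (Fin.succ ⟨0, hm'⟩), hT _, H.orth_symm _ _ (ho _ _ (Fin.succ_pos _))⟩
    obtain ⟨F, hF, hFW, hFc⟩ := ih (fun i => V i.succ) (fun i => U i.succ) (fun i => hUV _)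
      (fun i j hij => ho _ _ (Fin.succ_lt_succ_iff.2 hij)) W
      (fun i => hVW _ (hT _) (H.orth_symm _ _ (ho _ _ (Fin.succ_pos i)))) hm'
    have hlt : ∀ W' ∈ F, W' < T := fun W' h => (hFW W' h).trans_lt hW
    refine ⟨insert T F, ?_, ?_, ?_⟩
    · rw [Finset.card_insert_of_notMem fun h => (hlt T h).false, hF]
    · intro W' h
      rcases Finset.mem_insert.1 h with rfl | h
      exacts [le_rfl, (hlt _ h).le]
    · intro W1 h1 W2 h2
      rw [Finset.mem_insert] at h1 h2
      rcases h1 with rfl | h1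
      · exact h2.elim (fun h => Or.inl h.ge) (fun h => Or.inr (hlt _ h).le)
      · rcases h2 with rfl | h2
        exacts [Or.inl (hlt _ h1).le, hFc _ h1 _ h2]

theorem le_complexity_of_orth {m : ℕ} (V U : Fin m → S) (hUV : ∀ i, U i ≤ V i)
    (ho : ∀ i j, i < j → H.orth (U i) (V j)) : m ≤ H.complexity := by
  rcases Nat.eq_zero_or_pos m with rfl | hm
  · exact Nat.zero_le _
  · obtain ⟨T, hT⟩ := H.exists_top ⟨V ⟨0, hm⟩⟩
    obtain ⟨F, hF, -, hc⟩ := H.exists_chain_of_orth V U hUV ho T (fun i => hT _) hm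
    exact hF ▸ H.chain_bound F hc

/-- Large links and induction on rank: a relevant domain properly nested in `W` is nested in one of
finitely many smaller domains. -/
theorem finite_Rel {K : ℝ} (hK : H.E ≤ K) (a b : X) : (H.Rel K a b).Finite := by
  obtain ⟨rank, hrank, -⟩ := H.exists_rank
  have key : ∀ n, ∀ W, rank W = n → {U ∈ H.Rel K a b | U ≤ W}.Finite := by
    intro n
    induction n using Nat.strong_induction_on with
    | _ n ih =>
      intro W hW
      obtain ⟨F, -, hF, hF'⟩ := H.large_links W a b
      refine ((F.finite_toSet.biUnion fun T hT =>
        ih (rank T) (hW ▸ hrank (hF T hT).1) T rfl).insert W).subset ?_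
      rintro U ⟨hU, hUW⟩
      rcases hUW.eq_or_lt with rfl | hlt
      · exact mem_insert _ _
      · rcases hF' U hlt with ⟨T, hT, hUT⟩ | h
        · exact mem_insert_of_mem _ (mem_biUnion hT ⟨hU, hUT⟩)
        · exact absurd hU (not_lt.2 (h.le.trans hK))
  rcases isEmpty_or_nonempty S with h | h
  · exact Set.toFinite _
  · obtain ⟨M, hM⟩ := H.exists_top h
    exact (key _ M rfl).subset fun U hU => ⟨hU, hM U⟩

/-- Realizing relative projections by a point of `X` lets the consistency axioms, which concern
points, be applied to them. -/
theorem exists_near_rho (a : X) (V : S) : ∃ x : X, ∀ W, (V < W ∨ H.Transverse V W) →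
    ∃ p ∈ H.rho V W, dist (H.proj W x) p ≤ H.E := by
  obtain ⟨x, hx⟩ := H.partial_realization {V} (Set.pairwise_singleton _ _) fun _ => a
  exact ⟨x, (hx V rfl).2⟩

theorem exists_near_rho_of_orth (a : X) {U V : S} (h : H.orth U V) : ∃ x : X,
    (∀ W, (U < W ∨ H.Transverse U W) → ∃ p ∈ H.rho U W, dist (H.proj W x) p ≤ H.E) ∧
    ∀ W, (V < W ∨ H.Transverse V W) → ∃ p ∈ H.rho V W, dist (H.proj W x) p ≤ H.E := by
  obtain ⟨x, hx⟩ := H.partial_realization {U, V}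
    (Set.pairwise_pair.2 fun _ => ⟨h, H.orth_symm _ _ h⟩) fun _ => a
  exact ⟨x, (hx U (by simp)).2, (hx V (by simp)).2⟩

/-- Two geodesics with the same end points fellow-travel. -/
theorem dist_geodesic_le {U : S} {x y : C U} {γ γ' : ℝ → C U} (h : IsGeodesic γ x y)
    (h' : IsGeodesic γ' x y) {t : ℝ} (ht : t ∈ Icc 0 (dist x y)) :
    dist (γ t) (γ' t) ≤ 2 * H.E := by
  have hE := H.one_le_E
  -- Slimness is applied to the degenerate triangle `x`, `y`, `y`; comparing distances to `x` then
  -- aligns the parameters.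
  have hconst : IsGeodesic (fun _ => y) y y := by
    refine ⟨rfl, rfl, fun s hs t ht => ?_⟩
    rw [dist_self, Icc_self, mem_singleton_iff] at hs ht
    simp [hs, ht]
  have hD : dist x y ∈ Icc 0 (dist x y) := ⟨dist_nonneg, le_rfl⟩
  have key : ∀ s ∈ Icc 0 (dist x y), dist (γ t) (γ' s) ≤ H.E → dist (γ t) (γ' t) ≤ 2 * H.E := by
    intro s hs hst
    have h0 : (0 : ℝ) ∈ Icc 0 (dist x y) := ⟨le_rfl, dist_nonneg⟩
    have e1 := h.2.2 0 h0 t ht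
    have e2 := h'.2.2 0 h0 s hs
    have e3 := h'.2.2 s hs t ht
    rw [h.1, zero_sub, abs_neg, abs_of_nonneg ht.1] at e1
    rw [h'.1, zero_sub, abs_neg, abs_of_nonneg hs.1] at e2
    have h1 := dist_triangle x (γ t) (γ' s)
    have h2 := dist_triangle x (γ' s) (γ t)
    have h3 := dist_triangle (γ t) (γ' s) (γ' t)
    rw [dist_comm (γ' s) (γ t)] at h2
    have : |s - t| ≤ H.E := abs_le.2 ⟨by linarith, by linarith⟩
    linarith
  rcases (H.hyperbolic U).2 x y y γ (fun _ => y) γ' h hconst h' t ht with ⟨s, _, hs⟩ | ⟨s, hs, hst⟩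
  · exact key _ hD (by rw [h'.2.1]; exact hs)
  · exact key s hs hst

/-- If `y` is near `x` and both are far from `ρ^V_W`, then their images in `C V` are close. -/
theorem dist_rhoMap_le {V W : S} (hVW : V < W) {x y : C W} {c : ℝ} (hxy : dist x y ≤ c)
    (hfar : ∀ p ∈ H.rho V W, c + H.E < dist x p) :
    dist (H.rhoMap W V x) (H.rhoMap W V y) ≤ H.E := by
  obtain ⟨γ, hγ⟩ := (H.hyperbolic W).1 x y
  have h0 : (0 : ℝ) ∈ Icc 0 (dist x y) := ⟨le_rfl, dist_nonneg⟩
  have hD : dist x y ∈ Icc 0 (dist x y) := ⟨dist_nonneg, le_rfl⟩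
  rcases H.bounded_geodesic_image V W hVW x y γ hγ with ⟨t, ht, p, hp, htp⟩ | h
  · have e := hγ.2.2 0 h0 t ht
    rw [hγ.1, zero_sub, abs_neg, abs_of_nonneg ht.1] at e
    have := dist_triangle x (γ t) p
    have := hfar p hp
    linarith [ht.2]
  · have := h 0 h0 _ hD
    rwa [hγ.1, hγ.2.1] at this

end HHS

/-! ### Coarse geometry of interval systems -/

/-- A coarsely Lipschitz function on an interval almost attains intermediate values. -/
theorem exists_abs_sub_le_of_coarse {h : ℝ → ℝ} {c p q τ : ℝ} (hpq : p ≤ q)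
    (hh : ∀ s ∈ Icc p q, ∀ t ∈ Icc p q, |s - t| ≤ 1 → |h s - h t| ≤ c)
    (hp : h p ≤ τ) (hq : τ ≤ h q) : ∃ m ∈ Icc p q, |h m - τ| ≤ c := by
  -- Within `1` of the supremum of the sublevel set, a unit step to the right (or to `q`) reaches a
  -- value at least `τ`.
  set S := {m ∈ Icc p q | h m ≤ τ} with hS
  have hbdd : BddAbove S := ⟨q, fun m hm => hm.1.2⟩
  obtain ⟨m, hm, hlt⟩ := exists_lt_of_lt_csSup (s := S) ⟨p, ⟨le_rfl, hpq⟩, hp⟩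
    (sub_one_lt (sSup S))
  refine ⟨m, hm.1, ?_⟩
  obtain ⟨m', hm', hmm', hτ⟩ : ∃ m' ∈ Icc p q, |m - m'| ≤ 1 ∧ τ ≤ h m' := by
    rcases le_or_gt (m + 1) q with h1 | h1
    · have hmem : m + 1 ∈ Icc p q := ⟨by linarith [hm.1.1], h1⟩
      refine ⟨m + 1, hmem, by simp, ?_⟩
      by_contra! h2
      have := le_csSup hbdd (show m + 1 ∈ S from ⟨hmem, h2.le⟩)
      linarith
    · exact ⟨q, ⟨hpq, le_rfl⟩, abs_le.2 ⟨by linarith, by linarith [hm.1.2]⟩, hq⟩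
  have := abs_le.1 (hh m hm.1 m' hm' hmm')
  exact abs_le.2 ⟨by linarith, by linarith [hm.2, (abs_nonneg _).trans (hh m hm.1 m' hm' hmm')]⟩

section

variable {X : Type u} [MetricSpace X] {S : Type v} [PartialOrder S]
  {C : S → Type w} [∀ U, MetricSpace (C U)]

namespace IntervalSystem

variable {H : HHS X S C} {R K : ℝ} {a b : X} (I : IntervalSystem H R K a b)

/-- A lower bound for the radius of the clusters. -/
def radius (H : HHS X S C) (R : ℝ) : ℝ := R * (6 * R + 4 * H.E) + 3 * R

variable {I}

theorem abs_sub_le_of_dist_le (hR : 0 < R) {U : H.Rel K a b} {s t : ℝ} (hs : s ∈ Icc 0 (I.len U))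
    (ht : t ∈ Icc 0 (I.len U)) {c : ℝ} (h : dist (I.φ U s) (I.φ U t) ≤ c) :
    |s - t| ≤ R * (c + R) := by
  have := (I.φ_qi U s hs t ht).1
  rw [Real.dist_eq] at this
  have h1 : R⁻¹ * |s - t| ≤ c + R := by linarith
  rwa [inv_mul_le_iff₀ hR] at h1

/-- Every point of `T U` is close to the segment between the marked points. -/
theorem exists_mem_uIcc_abs_sub_le (hR : 0 < R) {U : H.Rel K a b} {t : ℝ}
    (ht : t ∈ Icc 0 (I.len U)) :
    ∃ m ∈ uIcc (I.ma U) (I.mb U), |t - m| ≤ R * (6 * R + 2 * H.E) := by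
  have hT : uIcc (I.ma U) (I.mb U) ⊆ Icc 0 (I.len U) := uIcc_subset_Icc (I.ma_mem U) (I.mb_mem U)
  obtain ⟨z, ⟨γ, hγ, τ, hτ, rfl⟩, hz⟩ := I.φ_near_hull U t ht
  -- The distance to the projection of `a` changes by at most `2 * R` over unit steps and runs from
  -- nearly `0` to nearly the full distance, so it almost attains `τ` between the marked points.
  set h : ℝ → ℝ := fun m => dist (H.proj U a) (I.φ U m) with hh
  have hjump : ∀ s ∈ Icc 0 (I.len U), ∀ t ∈ Icc 0 (I.len U), |s - t| ≤ 1 →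
      |h s - h t| ≤ 2 * R := by
    intro s hs t ht hst
    have h1 := (I.φ_qi U s hs t ht).2
    rw [Real.dist_eq] at h1
    have h2 := abs_dist_sub_le (I.φ U s) (I.φ U t) (H.proj U a)
    rw [dist_comm _ (H.proj U a), dist_comm _ (H.proj U a)] at h2
    nlinarith
  have hma : |h (I.ma U)| ≤ R := by
    rw [abs_of_nonneg dist_nonneg]
    exact (dist_comm _ _).trans_le (I.ma_close U)
  have hmb : dist (H.proj U a) (H.proj U b) - R ≤ h (I.mb U) := by
    have := dist_triangle (H.proj U a) (I.φ U (I.mb U)) (H.proj U b)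
    have := I.mb_close U
    simp only [hh]; linarith
  obtain ⟨m, hm, hmτ⟩ : ∃ m ∈ uIcc (I.ma U) (I.mb U), |h m - τ| ≤ 2 * R := by
    rw [abs_le] at hma
    rcases le_or_gt (h (I.ma U)) τ with h1 | h1
    · rcases le_or_gt τ (h (I.mb U)) with h2 | h2
      · rcases le_total (I.ma U) (I.mb U) with h3 | h3
        · rw [uIcc_of_le h3] at hT ⊢
          exact exists_abs_sub_le_of_coarse h3
            (fun s hs t ht => hjump s (hT hs) t (hT ht)) h1 h2
        · rw [uIcc_of_ge h3] at hT ⊢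
          obtain ⟨m, hm, hm'⟩ := exists_abs_sub_le_of_coarse (h := fun m => - h m) (τ := -τ)
            (c := 2 * R) h3
            (fun s hs t ht hst => by
              rw [neg_sub_neg, abs_sub_comm]; exact hjump s (hT hs) t (hT ht) hst)
            (neg_le_neg h2) (neg_le_neg h1)
          refine ⟨m, hm, ?_⟩
          rwa [neg_sub_neg, abs_sub_comm] at hm'
      · exact ⟨_, right_mem_uIcc, abs_le.2 ⟨by linarith [hτ.2], by linarith⟩⟩
    · exact ⟨_, left_mem_uIcc, abs_le.2 ⟨by linarith, by linarith [hτ.1]⟩⟩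
  refine ⟨m, hm, ?_⟩
  obtain ⟨z', ⟨γ', hγ', τ', hτ', rfl⟩, hz'⟩ := I.φ_near_hull U m (hT hm)
  have h0 : (0 : ℝ) ∈ Icc 0 (dist (H.proj U a) (H.proj U b)) := ⟨le_rfl, dist_nonneg⟩
  have e1 := hγ'.2.2 0 h0 τ' hτ'
  rw [hγ'.1, zero_sub, abs_neg, abs_of_nonneg hτ'.1] at e1
  have e2 := hγ'.2.2 τ hτ τ' hτ'
  have e3 := H.dist_geodesic_le hγ hγ' hτ
  have h1 := abs_le.1 hmτ
  have h2 := dist_triangle (H.proj U a) (I.φ U m) (γ' τ')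
  have h3 := dist_triangle (H.proj U a) (γ' τ') (I.φ U m)
  rw [dist_comm (γ' τ')] at h3
  have h4 : |τ - τ'| ≤ 3 * R := abs_le.2 ⟨by simp only [hh] at h1; linarith,
    by simp only [hh] at h1; linarith⟩
  -- Sum of `R` twice for leaving the geodesics, `2 * E` for fellow-travelling and `3 * R` for the
  -- parameters.
  have h5 : dist (I.φ U t) (I.φ U m) ≤ 5 * R + 2 * H.E := by
    have := dist_triangle4 (I.φ U t) (γ τ) (γ' τ) (γ' τ')
    have := dist_triangle (I.φ U t) (γ' τ') (I.φ U m)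
    rw [dist_comm (γ' τ')] at this
    linarith
  refine (abs_sub_le_of_dist_le hR ht (hT hm) h5).trans_eq (by ring)

/-! ### The collapsed intervals -/

variable (I) in
/-- The marked points and the points of the projections of nested domains. -/
def IsBase (U : H.Rel K a b) (t : ℝ) : Prop := t = I.ma U ∨ t = I.mb U ∨ ∃ V, V < U ∧ t ∈ I.δ V U

theorem isBase_ma (U : H.Rel K a b) : I.IsBase U (I.ma U) := Or.inl rfl

theorem isBase_mb (U : H.Rel K a b) : I.IsBase U (I.mb U) := Or.inr (Or.inl rfl)

theorem IsBase.mem {U : H.Rel K a b} {t : ℝ} (h : I.IsBase U t) : t ∈ Icc 0 (I.len U) := by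
  rcases h with rfl | rfl | ⟨V, hV, ht⟩
  exacts [I.ma_mem U, I.mb_mem U, (I.δ_subset V U (Or.inl hV)).1 ht]

variable {r₁ r₂ : ℝ}

theorem IsBase.mem_nbhd {U : H.Rel K a b} {s t : ℝ} (h : I.IsBase U t) (hs : s ∈ Icc 0 (I.len U))
    (hst : |s - t| ≤ r₁) : s ∈ I.nbhd r₁ U := by
  refine ⟨hs, ?_⟩
  rcases h with rfl | rfl | ⟨V, hV, ht⟩
  · exact Or.inl (Or.inl (Metric.mem_cthickening_of_dist_le s _ r₁ _ (mem_singleton _) hst))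
  · exact Or.inl (Or.inr (Metric.mem_cthickening_of_dist_le s _ r₁ _ (mem_singleton _) hst))
  · exact Or.inr (mem_biUnion hV (Metric.mem_cthickening_of_dist_le s _ r₁ _ ht hst))

theorem nbhd_subset_clusters (hr₂ : 0 < r₂) (U : H.Rel K a b) :
    I.nbhd r₁ U ⊆ I.clusters r₁ r₂ U := fun t ht =>
  ⟨t, ht, t, ht, le_rfl, le_rfl, by simpa using hr₂.le⟩

theorem uIcc_subset_of_abs_sub_le {s t c : ℝ} (h : |s - t| ≤ c) : ∀ m ∈ uIcc s t, |m - t| ≤ c := by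
  intro m hm
  rw [abs_sub_comm] at h ⊢
  exact (abs_sub_right_of_mem_uIcc hm).trans h

theorem IsBase.q_eq (hr₂ : 0 < r₂) {U : H.Rel K a b} {s t : ℝ} (h : I.IsBase U t)
    (hs : s ∈ Icc 0 (I.len U)) (hst : |s - t| ≤ r₁) : I.q r₁ r₂ U s = I.q r₁ r₂ U t := by
  refine collapse_eq_of_uIcc_subset hs.1 h.mem.1 fun m hm => nbhd_subset_clusters hr₂ U ?_
  exact h.mem_nbhd (uIcc_subset_Icc hs h.mem hm) (uIcc_subset_of_abs_sub_le hst m hm)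

/-- The projection need not be closed, so the nearby point is only in its closure; both the segment
to it and the one from it to `t` lie in the cluster part. -/
theorem exists_q_eq_of_mem_cthickening (hR : 0 < R) (hr₂ : 0 < r₂) (hr₁ : R ≤ r₁)
    {U V : H.Rel K a b} (hV : V < U) {x : ℝ} (hx : x ∈ Icc 0 (I.len U))
    (h : x ∈ Metric.cthickening r₁ (I.δ V U)) :
    ∃ t ∈ I.δ V U, I.q r₁ r₂ U x = I.q r₁ r₂ U t := by
  have hsub := (I.δ_subset V U (Or.inl hV)).1
  obtain ⟨t, ht⟩ := (I.δ_subset V U (Or.inl hV)).2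
  have hbase : I.IsBase U t := Or.inr (Or.inr ⟨V, hV, ht⟩)
  rw [Metric.cthickening_eq_biUnion_closedBall _ (hR.le.trans hr₁)] at h
  obtain ⟨y, hy, hxy⟩ := mem_iUnion₂.1 h
  have hyT : y ∈ Icc 0 (I.len U) := closure_minimal hsub isClosed_Icc hy
  have hyt : |y - t| ≤ R := by
    have : I.δ V U ⊆ Metric.closedBall t R := fun z hz => I.δ_diam V U (Or.inl hV) z hz t ht
    exact closure_minimal this Metric.isClosed_closedBall hy
  refine ⟨t, ht, Eq.trans ?_ (hbase.q_eq hr₂ hyT (hyt.trans hr₁))⟩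
  refine collapse_eq_of_uIcc_subset hx.1 hyT.1 fun m hm => nbhd_subset_clusters hr₂ U ?_
  refine ⟨uIcc_subset_Icc hx hyT hm, Or.inr (mem_biUnion hV ?_)⟩
  rw [Metric.cthickening_eq_biUnion_closedBall _ (hR.le.trans hr₁)]
  exact mem_biUnion hy (uIcc_subset_of_abs_sub_le hxy m hm)

/-- Every cluster contains a base point. -/
theorem exists_isBase_of_mem_clusters (hR : 0 < R) (hr₂ : 0 < r₂) (hr₁ : R ≤ r₁)
    {U : H.Rel K a b} {c : ℝ} (hc : c ∈ I.clusters r₁ r₂ U) :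
    ∃ t, I.IsBase U t ∧ I.q r₁ r₂ U c = I.q r₁ r₂ U t := by
  obtain ⟨x, hx, y, hy, hxc, hcy, hyx⟩ := hc
  have hqc : I.q r₁ r₂ U x = I.q r₁ r₂ U c := by
    refine collapse_eq_of_Icc_subset hx.1.1 hxc fun m hm => ?_
    exact ⟨x, hx, y, hy, hm.1, hm.2.trans hcy, hyx⟩
  have hr : 0 ≤ r₁ := hR.le.trans hr₁
  rw [← hqc]
  rcases hx.2 with (h | h) | h
  · rw [Metric.cthickening_singleton _ hr] at h
    exact ⟨_, isBase_ma U, (isBase_ma U).q_eq hr₂ hx.1 h⟩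
  · rw [Metric.cthickening_singleton _ hr] at h
    exact ⟨_, isBase_mb U, (isBase_mb U).q_eq hr₂ hx.1 h⟩
  · obtain ⟨V, hV, h⟩ := mem_iUnion₂.1 h
    obtain ⟨t, ht, e⟩ := exists_q_eq_of_mem_cthickening hR hr₂ hr₁ hV hx.1 h
    exact ⟨t, Or.inr (Or.inr ⟨V, hV, ht⟩), e⟩

variable (I) in
/-- The end point of the collapsed interval that represents `a`. -/
noncomputable def endA (r₁ r₂ : ℝ) (U : H.Rel K a b) : ℝ := I.q r₁ r₂ U (I.ma U)

variable (I) in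
/-- The end point of the collapsed interval that represents `b`. -/
noncomputable def endB (r₁ r₂ : ℝ) (U : H.Rel K a b) : ℝ := I.q r₁ r₂ U (I.mb U)

open Classical in
variable (I) in
/-- The point to which the projection of `V` to `T U` is collapsed. -/
noncomputable def hatPt (r₁ r₂ : ℝ) (V U : H.Rel K a b) : ℝ :=
  if h : (I.δ V U).Nonempty then I.q r₁ r₂ U h.some else 0

theorem radius_pos (hR : 0 < R) : 0 < radius H R := by
  have := H.one_le_E
  rw [radius]; positivity

theorem le_radius (hR : 0 < R) : R ≤ radius H R := by
  have := H.one_le_E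
  have : 0 ≤ R * (6 * R + 4 * H.E) := by positivity
  rw [radius]; linarith

/-- A point beyond the marked points is at least as close to the marked point on its side as to any
point between them, so it falls into that mark's cluster. -/
theorem q_mem_uIcc (hR : 0 < R) (hr₁ : radius H R < r₁) (hr₂ : 0 < r₂) {U : H.Rel K a b} {t : ℝ}
    (ht : t ∈ Icc 0 (I.len U)) :
    I.q r₁ r₂ U t ∈ uIcc (I.endA r₁ r₂ U) (I.endB r₁ r₂ U) := by
  have hE := H.one_le_E
  obtain ⟨m, hm, htm⟩ := exists_mem_uIcc_abs_sub_le hR ht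
  have hle : |t - m| ≤ r₁ := by
    refine htm.trans (le_trans ?_ hr₁.le)
    rw [radius]; nlinarith
  have hmono : Monotone (I.q r₁ r₂ U) := collapse_mono _
  by_cases h : t ∈ uIcc (I.ma U) (I.mb U)
  · exact hmono.mapsTo_uIcc h
  · have hend : ∀ s, I.IsBase U s → |t - s| ≤ |t - m| → I.q r₁ r₂ U t = I.q r₁ r₂ U s :=
      fun s hs h => hs.q_eq hr₂ ht (h.trans hle)
    rw [mem_uIcc] at hm h
    push Not at h
    have key : |t - I.ma U| ≤ |t - m| ∨ |t - I.mb U| ≤ |t - m| := by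
      rcases hm with hm | hm
      · rcases le_or_gt (I.ma U) t with h1 | h1
        · have := h.1 h1
          right
          rw [abs_of_pos (by linarith), abs_of_pos (by linarith)]; linarith
        · left
          rw [abs_of_neg (by linarith), abs_of_neg (by linarith)]; linarith
      · rcases le_or_gt (I.mb U) t with h1 | h1
        · have := h.2 h1
          left
          rw [abs_of_pos (by linarith), abs_of_pos (by linarith)]; linarith
        · right
          rw [abs_of_neg (by linarith), abs_of_neg (by linarith)]; linarith
    rcases key with k | k
    · rw [hend _ (isBase_ma U) k]; exact left_mem_uIcc
    · rw [hend _ (isBase_mb U) k]; exact right_mem_uIcc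

theorem q_image (hR : 0 < R) (hr₁ : radius H R < r₁) (hr₂ : 0 < r₂) (U : H.Rel K a b) :
    I.q r₁ r₂ U '' Icc 0 (I.len U) = uIcc (I.endA r₁ r₂ U) (I.endB r₁ r₂ U) := by
  refine Subset.antisymm (image_subset_iff.2 fun t ht => q_mem_uIcc hR hr₁ hr₂ ht) ?_
  refine (intermediate_value_uIcc (continuous_collapse _).continuousOn).trans (image_mono ?_)
  exact uIcc_subset_Icc (I.ma_mem U) (I.mb_mem U)

/-- The projection of a nested or transverse domain is near a base point. -/
theorem exists_isBase_near {U V : H.Rel K a b} (h : V < U ∨ H.Transverse (V : S) U) {s : ℝ}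
    (hs : s ∈ I.δ V U) (hR : 0 < R) : ∃ m, I.IsBase U m ∧ |s - m| ≤ 2 * R := by
  by_cases ht : H.Transverse (V : S) U
  · obtain ⟨s', hs', h'⟩ := I.δ_marked V U ht
    have hss' := I.δ_diam V U (Or.inr ht) s hs s' hs'
    rcases h' with h' | h'
    · exact ⟨_, isBase_ma U, (abs_sub_le s s' _).trans (by linarith)⟩
    · exact ⟨_, isBase_mb U, (abs_sub_le s s' _).trans (by linarith)⟩
  · exact ⟨s, Or.inr (Or.inr ⟨V, h.resolve_right ht, hs⟩), by simpa using hR.le⟩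

/-- Points near the projection of `V` are collapsed to the collapsed projection of `V`. -/
theorem q_eq_hatPt (hR : 0 < R) (hr₂ : 0 < r₂) {U V : H.Rel K a b}
    (h : V < U ∨ H.Transverse (V : S) U) {s t : ℝ} (hs : s ∈ I.δ V U) (ht : t ∈ Icc 0 (I.len U))
    (hst : |t - s| + 3 * R ≤ r₁) : I.q r₁ r₂ U t = I.hatPt r₁ r₂ V U := by
  have hne : (I.δ V U).Nonempty := ⟨s, hs⟩
  rw [hatPt, dif_pos hne]
  obtain ⟨m, hm, hsm⟩ := exists_isBase_near h hs hR
  have h1 := I.δ_diam V U h _ hne.some_mem s hs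
  have h2 := abs_sub_le t s m
  have h3 := abs_sub_le hne.some s m
  have h4 := abs_nonneg (t - s)
  rw [hm.q_eq hr₂ ht (by linarith), hm.q_eq hr₂ ((I.δ_subset V U h).1 hne.some_mem) (by linarith)]

/-- Pulling back through `φ U` costs `R * (3 * R + 4 * E)`, and `3 * R` more reaches a base point;
`radius` covers this sum. The tolerance `R + 3 * E` is the error accumulated in
`hatPt_eq_of_dist_le` and `IsMark.hatPt_eq`. -/
theorem q_eq_hatPt_of_dist_le (hR : 0 < R) (hr₁ : radius H R < r₁) (hr₂ : 0 < r₂)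
    {U V : H.Rel K a b} (h : V < U ∨ H.Transverse (V : S) U) {t : ℝ} (ht : t ∈ Icc 0 (I.len U))
    {p : C U} (hp : p ∈ H.rho (V : S) U) (htp : dist (I.φ U t) p ≤ R + 3 * H.E) :
    I.q r₁ r₂ U t = I.hatPt r₁ r₂ V U := by
  have hE := H.one_le_E
  obtain ⟨s, hs, p', hp', hsp⟩ := I.δ_rho V U h
  have h1 := H.rho_diam _ _ h p hp p' hp'
  have h2 : dist (I.φ U t) (I.φ U s) ≤ 2 * R + 4 * H.E := by
    have := dist_triangle4 (I.φ U t) p p' (I.φ U s)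
    rw [dist_comm p'] at this
    linarith
  refine q_eq_hatPt hR hr₂ h hs ht ?_
  have := abs_sub_le_of_dist_le hR ht ((I.δ_subset V U h).1 hs) h2
  rw [radius] at hr₁
  nlinarith

/-- Hence the choice made in `hatPt` is immaterial. -/
theorem hatPt_eq_q (hR : 0 < R) (hr₁ : radius H R < r₁) (hr₂ : 0 < r₂) {U V : H.Rel K a b}
    (h : V < U ∨ H.Transverse (V : S) U) {s : ℝ} (hs : s ∈ I.δ V U) :
    I.q r₁ r₂ U s = I.hatPt r₁ r₂ V U := by
  have hE := H.one_le_E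
  refine q_eq_hatPt hR hr₂ h hs ((I.δ_subset V U h).1 hs) ?_
  rw [radius] at hr₁
  rw [sub_self, abs_zero]
  nlinarith

theorem hatPt_mem_uIcc (hR : 0 < R) (hr₁ : radius H R < r₁) (hr₂ : 0 < r₂) {U V : H.Rel K a b}
    (h : V < U ∨ H.Transverse (V : S) U) :
    I.hatPt r₁ r₂ V U ∈ uIcc (I.endA r₁ r₂ U) (I.endB r₁ r₂ U) := by
  obtain ⟨s, hs⟩ := (I.δ_subset V U h).2
  rw [← hatPt_eq_q hR hr₁ hr₂ h hs]
  exact q_mem_uIcc hR hr₁ hr₂ ((I.δ_subset V U h).1 hs)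

theorem hatPt_eq_of_abs_sub_le (hR : 0 < R) (hr₁ : radius H R < r₁) (hr₂ : 0 < r₂)
    {U V W : H.Rel K a b} (hU : U < W ∨ H.Transverse (U : S) W)
    (hV : V < W ∨ H.Transverse (V : S) W)
    (h : ∀ s ∈ I.δ U W ∪ I.δ V W, ∀ t ∈ I.δ U W ∪ I.δ V W, |s - t| ≤ R) :
    I.hatPt r₁ r₂ U W = I.hatPt r₁ r₂ V W := by
  have hE := H.one_le_E
  obtain ⟨s, hs⟩ := (I.δ_subset U W hU).2
  obtain ⟨t, ht⟩ := (I.δ_subset V W hV).2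
  rw [← hatPt_eq_q hR hr₁ hr₂ hU hs]
  refine q_eq_hatPt hR hr₂ hV ht ((I.δ_subset U W hU).1 hs) ?_
  have := h s (Or.inl hs) t (Or.inr ht)
  rw [radius] at hr₁
  nlinarith

/-- One common witness `x` turns two coarse statements into an exact equality after collapsing. -/
theorem hatPt_eq_of_dist_le (hR : 0 < R) (hr₁ : radius H R < r₁) (hr₂ : 0 < r₂)
    {U V W : H.Rel K a b} (hU : U < W ∨ H.Transverse (U : S) W)
    (hV : V < W ∨ H.Transverse (V : S) W) {x : C W}
    (hxU : ∃ p ∈ H.rho (U : S) W, dist x p ≤ H.E) (hxV : ∃ p ∈ H.rho (V : S) W, dist x p ≤ H.E) :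
    I.hatPt r₁ r₂ U W = I.hatPt r₁ r₂ V W := by
  obtain ⟨s, hs, p, hp, hsp⟩ := I.δ_rho U W hU
  obtain ⟨p₁, hp₁, h1⟩ := hxU
  obtain ⟨p₂, hp₂, h2⟩ := hxV
  rw [← hatPt_eq_q hR hr₁ hr₂ hU hs]
  refine q_eq_hatPt_of_dist_le hR hr₁ hr₂ hV ((I.δ_subset U W hU).1 hs) hp₂ ?_
  have h3 := H.rho_diam _ _ hU p hp p₁ hp₁
  have h4 := dist_triangle4 (I.φ W s) p p₁ p₂
  have h5 := dist_triangle p₁ x p₂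
  rw [dist_comm p₁ x] at h5
  linarith

/-! ### Marked points -/

variable (I) in
/-- `m U ∈ T U` are marked points representing the projections of `c`. -/
structure IsMark (c : X) (m : H.Rel K a b → ℝ) : Prop where
  isBase : ∀ U, I.IsBase U (m U)
  dist_le : ∀ U : H.Rel K a b, dist (I.φ U (m U)) (H.proj U c) ≤ R

theorem isMark_ma : I.IsMark a I.ma := ⟨isBase_ma, I.ma_close⟩

theorem isMark_mb : I.IsMark b I.mb := ⟨isBase_mb, I.mb_close⟩

variable {c : X} {m : H.Rel K a b → ℝ}

/-- Consistency of the projections of `c` for transverse domains. -/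
theorem IsMark.hatPt_eq_or (hm : I.IsMark c m) (hR : 0 < R) (hr₁ : radius H R < r₁) (hr₂ : 0 < r₂)
    {U V : H.Rel K a b} (h : H.Transverse (U : S) V) :
    I.hatPt r₁ r₂ V U = I.q r₁ r₂ U (m U) ∨ I.hatPt r₁ r₂ U V = I.q r₁ r₂ V (m V) := by
  have hE := H.one_le_E
  have key : ∀ U V : H.Rel K a b, H.Transverse (V : S) U →
      (∃ p ∈ H.rho (V : S) U, dist (H.proj U c) p ≤ H.E) →
      I.hatPt r₁ r₂ V U = I.q r₁ r₂ U (m U) := by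
    rintro U V h ⟨p, hp, hcp⟩
    refine (q_eq_hatPt_of_dist_le hR hr₁ hr₂ (Or.inr h) (hm.isBase U).mem hp ?_).symm
    have := dist_triangle (I.φ U (m U)) (H.proj U c) p
    linarith [hm.dist_le U]
  rcases H.consistent_transverse _ _ h c with h' | h'
  · exact Or.inr (key V U h h')
  · exact Or.inl (key U V (H.transverse_symm h) h')

/-- A mark not collapsed onto the projection of `U` is far from `ρ^U_V`. So bounded geodesic image
moves it to the projection of `c`, and nested consistency of `c` can only hold through its second
alternative. -/
theorem IsMark.dist_rhoMap_le (hm : I.IsMark c m) (hR : 0 < R) (hr₁ : radius H R < r₁)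
    (hr₂ : 0 < r₂) {U V : H.Rel K a b} (hUV : U < V)
    (hne : I.q r₁ r₂ V (m V) ≠ I.hatPt r₁ r₂ U V) :
    dist (H.rhoMap (V : S) U (I.φ V (m V))) (H.proj U c) ≤ 2 * H.E := by
  have hE := H.one_le_E
  have hfar : ∀ p ∈ H.rho (U : S) V, R + H.E < dist (I.φ V (m V)) p := by
    intro p hp
    by_contra! h
    exact hne (q_eq_hatPt_of_dist_le hR hr₁ hr₂ (Or.inl hUV) (hm.isBase V).mem hp (by linarith))
  have h1 := H.dist_rhoMap_le (show (U : S) < V from hUV) (hm.dist_le V) hfar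
  rcases H.consistent_nested U V hUV c with ⟨p, hp, h⟩ | h
  · have := dist_triangle (I.φ V (m V)) (H.proj V c) p
    linarith [hm.dist_le V, hfar p hp]
  · rw [dist_comm] at h
    have := dist_triangle (H.rhoMap (V : S) U (I.φ V (m V))) (H.rhoMap (V : S) U (H.proj V c))
      (H.proj U c)
    linarith

/-- Away from the projection of `U`, a point is far from it in `T V`. -/
theorem lt_abs_sub_of_ne (hR : 0 < R) (hr₁ : radius H R < r₁) (hr₂ : 0 < r₂) {U V : H.Rel K a b}
    (hUV : U < V) {s : ℝ} (hs : s ∈ Icc 0 (I.len V))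
    (hne : I.q r₁ r₂ V s ≠ I.hatPt r₁ r₂ U V) : ∀ p ∈ I.δ U V, R < |s - p| := by
  have hE := H.one_le_E
  intro p hp
  by_contra! h
  refine hne (q_eq_hatPt hR hr₂ (Or.inl hUV) hp hs ?_)
  rw [radius] at hr₁
  nlinarith

/-- Bounded geodesic image: on the side of the marked point of `T V`, the projection to the nested
domain `U` is collapsed to the marked point. -/
theorem IsMark.q_eq_of_mem_δmap (hm : I.IsMark c m) (hR : 0 < R) (hr₁ : radius H R < r₁)
    (hr₂ : 0 < r₂) {U V : H.Rel K a b} (hUV : U < V) {s : ℝ} (hs : s ∈ Icc 0 (I.len V))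
    (hside : I.hatPt r₁ r₂ U V ∉ uIcc (I.q r₁ r₂ V s) (I.q r₁ r₂ V (m V)))
    {x : ℝ} (hx : x ∈ I.δmap V U s) : I.q r₁ r₂ U x = I.q r₁ r₂ U (m U) := by
  have hE := H.one_le_E
  have hmV := (hm.isBase V).mem
  have hmono : Monotone (I.q r₁ r₂ V) := collapse_mono _
  -- By monotonicity of `q`, a point of the segment near `δ^U_V` would place the collapsed
  -- projection between the ends.
  have hfar : ∀ z ∈ uIcc s (m V), ∀ p ∈ I.δ U V, R < |z - p| := by
    intro z hz
    refine lt_abs_sub_of_ne hR hr₁ hr₂ hUV (uIcc_subset_Icc hs hmV hz) fun e => hside ?_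
    rw [← e]
    exact hmono.mapsTo_uIcc hz
  obtain ⟨y, hy⟩ := (I.δmap_subset V U hUV _ hmV).2
  have hxy : |x - y| ≤ R := by
    rcases le_total s (m V) with h | h
    · exact I.δmap_bgi U V hUV s hs _ hmV h (fun z hz => hfar z (Icc_subset_uIcc hz)) x hx y hy
    · rw [abs_sub_comm]
      exact I.δmap_bgi U V hUV _ hmV s hs h (fun z hz => hfar z (Icc_subset_uIcc' hz)) y hy x hx
  have h1 := I.δmap_rho U V hUV _ hmV (hfar _ right_mem_uIcc) y hy
  have h2 := hm.dist_rhoMap_le hR hr₁ hr₂ hUV fun e => hside (e ▸ right_mem_uIcc)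
  have hyT := (I.δmap_subset V U hUV _ hmV).1 hy
  have h3 : dist (I.φ U y) (I.φ U (m U)) ≤ 2 * R + 2 * H.E := by
    have := dist_triangle4 (I.φ U y) (H.rhoMap (V : S) U (I.φ V (m V))) (H.proj U c) (I.φ U (m U))
    have := hm.dist_le U
    rw [dist_comm] at this
    linarith
  have h4 := abs_sub_le_of_dist_le hR hyT (hm.isBase U).mem h3
  refine (hm.isBase U).q_eq hr₂ ((I.δmap_subset V U hUV _ hs).1 hx) ?_
  have := abs_sub_le x y (m U)
  rw [radius] at hr₁
  nlinarith

/-- If `U` and `W` are transverse and nested in `V`, and the projection of `U` to `T V` does not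
separate that of `W` from the marked point, then `W` projects to the marked point of `T U`. -/
theorem IsMark.hatPt_eq (hm : I.IsMark c m) (hR : 0 < R) (hr₁ : radius H R < r₁)
    (hr₂ : 0 < r₂) {U V W : H.Rel K a b} (hUV : U < V) (hWV : W < V) (hUW : H.Transverse (U : S) W)
    (hside : I.hatPt r₁ r₂ U V ∉ uIcc (I.hatPt r₁ r₂ W V) (I.q r₁ r₂ V (m V))) :
    I.hatPt r₁ r₂ W U = I.q r₁ r₂ U (m U) := by
  have hE := H.one_le_E
  have hWU := H.transverse_symm hUW
  -- The point `x` realizes `W`. Consistency of `x` for `U ⊏ V` shows that `ρ^W_U` is close to the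
  -- image of `ρ^W_V` under `ρ^V_U`, and that image collapses to the mark by bounded geodesic image.
  obtain ⟨x, hx⟩ := H.exists_near_rho c W
  obtain ⟨s, hs, p, hp, hsp⟩ := I.δ_rho W V (Or.inl hWV)
  have hsT := (I.δ_subset W V (Or.inl hWV)).1 hs
  have hqs := hatPt_eq_q hR hr₁ hr₂ (Or.inl hWV) hs
  have hne : I.q r₁ r₂ V s ≠ I.hatPt r₁ r₂ U V := fun e => hside (by
    rw [← e, hqs]; exact left_mem_uIcc)
  obtain ⟨p₁, hp₁, h1⟩ := hx V (Or.inl hWV)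
  have h2 := H.rho_diam _ _ (Or.inl hWV) p hp p₁ hp₁
  have hsx : dist (I.φ V s) (H.proj V x) ≤ R + 2 * H.E := by
    have := dist_triangle4 (I.φ V s) p p₁ (H.proj V x)
    rw [dist_comm p₁] at this
    linarith
  rcases H.consistent_nested U V hUV x with h | h
  · refine absurd (hatPt_eq_of_dist_le (I := I) hR hr₁ hr₂ (Or.inl hWV) (Or.inl hUV) ⟨p₁, hp₁, h1⟩ h) ?_
    rw [← hqs]; exact hne
  · have hfar : ∀ p ∈ H.rho (U : S) V, R + 2 * H.E + H.E < dist (I.φ V s) p := by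
      intro p hp
      by_contra! h
      exact hne (q_eq_hatPt_of_dist_le hR hr₁ hr₂ (Or.inl hUV) hsT hp (by linarith))
    have h3 := H.dist_rhoMap_le (show (U : S) < V from hUV) hsx hfar
    obtain ⟨y, hy⟩ := (I.δmap_subset V U hUV _ hsT).2
    have h4 := I.δmap_rho U V hUV _ hsT (lt_abs_sub_of_ne hR hr₁ hr₂ hUV hsT hne) y hy
    obtain ⟨p₃, hp₃, h5⟩ := hx U (Or.inr hWU)
    rw [← hm.q_eq_of_mem_δmap hR hr₁ hr₂ hUV hsT (by rwa [hqs]) hy]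
    refine (q_eq_hatPt_of_dist_le hR hr₁ hr₂ (Or.inr hWU)
      ((I.δmap_subset V U hUV _ hsT).1 hy) hp₃ ?_).symm
    have h6 := dist_triangle4 (I.φ U y) (H.rhoMap (V : S) U (I.φ V s))
      (H.rhoMap (V : S) U (H.proj V x)) p₃
    have h7 := dist_triangle (H.rhoMap (V : S) U (H.proj V x)) (H.proj U x) p₃
    rw [dist_comm _ (H.proj U x)] at h7
    linarith

/-- The marked points of a sufficiently relevant domain are far from each other. -/
theorem lt_abs_sub_marks (hR : 0 < R) (U : H.Rel K a b) : (K - 3 * R) / R < |I.ma U - I.mb U| := by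
  have h1 : K < dist (H.proj U a) (H.proj U b) := U.2
  have h2 := (I.φ_qi U _ (I.ma_mem U) _ (I.mb_mem U)).2
  have h3 := dist_triangle4 (H.proj U a) (I.φ U (I.ma U)) (I.φ U (I.mb U)) (H.proj U b)
  rw [Real.dist_eq] at h2
  rw [dist_comm (H.proj U a) (I.φ U (I.ma U))] at h3
  rw [div_lt_iff₀ hR]
  linarith [I.ma_close U, I.mb_close U]

/-- A domain which is minimal among the relevant ones has a long collapsed interval. -/
theorem le_abs_endA_sub_endB (hr₁ : 0 ≤ r₁) (hr₂ : 0 < r₂) {U : H.Rel K a b}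
    (hU : IsMin U) : |I.ma U - I.mb U| - 2 * r₁ - r₂ ≤ |I.endA r₁ r₂ U - I.endB r₁ r₂ U| := by
  have key : ∀ s t, 0 ≤ s → s ≤ t →
      (∀ x ∈ I.nbhd r₁ U, |x - s| ≤ r₁ ∨ |x - t| ≤ r₁) →
      t - s - 2 * r₁ - r₂ ≤ I.q r₁ r₂ U t - I.q r₁ r₂ U s := by
    intro s t hs hst hx
    have hmono : Monotone (I.q r₁ r₂ U) := collapse_mono _
    rcases le_or_gt (t - s) (2 * r₁ + r₂) with h | h
    · linarith [hmono hst]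
    -- Without nested domains only the two marks have neighbourhoods, and the gap between them
    -- exceeds `r₂`, so no segment bridges it.
    have hdisj : Disjoint (I.clusters r₁ r₂ U) (Ioo (s + r₁) (t - r₁)) := by
      refine Set.disjoint_left.2 ?_
      rintro z ⟨x, hxn, y, hyn, hxz, hzy, hxy⟩ ⟨hz1, hz2⟩
      rcases hx x hxn with h1 | h1 <;> rw [abs_le] at h1
      · rcases hx y hyn with h2 | h2 <;> rw [abs_le] at h2 <;> linarith
      · linarith
    have h1 := collapse_of_disjoint (A := I.clusters r₁ r₂ U) (s := s + r₁) (t := t - r₁)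
      (by linarith) (by linarith) hdisj
    have h2 : I.q r₁ r₂ U s ≤ I.q r₁ r₂ U (s + r₁) := hmono (by linarith)
    have h3 : I.q r₁ r₂ U (t - r₁) ≤ I.q r₁ r₂ U t := hmono (by linarith)
    have h4 : I.q r₁ r₂ U (t - r₁) - I.q r₁ r₂ U (s + r₁) = t - r₁ - (s + r₁) := h1
    linarith
  have hn : ∀ x ∈ I.nbhd r₁ U, |x - I.ma U| ≤ r₁ ∨ |x - I.mb U| ≤ r₁ := by
    intro x hx
    rcases hx.2 with (h | h) | h
    · rw [Metric.cthickening_singleton _ hr₁] at h; exact Or.inl h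
    · rw [Metric.cthickening_singleton _ hr₁] at h; exact Or.inr h
    · obtain ⟨V, hV, -⟩ := mem_iUnion₂.1 h
      exact absurd hV hU.not_lt
  rcases le_total (I.ma U) (I.mb U) with h | h
  · have := key _ _ (I.ma_mem U).1 h hn
    rw [abs_sub_comm, abs_of_nonneg (sub_nonneg.2 h), abs_sub_comm]
    exact this.trans (le_abs_self _)
  · have := key _ _ (I.mb_mem U).1 h fun x hx => (hn x hx).symm
    rw [abs_of_nonneg (sub_nonneg.2 h)]
    exact this.trans (le_abs_self _)

/-! ### Orienting the collapsed intervals -/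

variable (I) in
/-- The sign of the direction in which the collapsed interval is traversed from `a` to `b`. -/
noncomputable def sgn (r₁ r₂ : ℝ) (U : H.Rel K a b) : ℝ :=
  if I.endA r₁ r₂ U ≤ I.endB r₁ r₂ U then 1 else -1

theorem sgn_cases (U : H.Rel K a b) :
    (I.sgn r₁ r₂ U = 1 ∧ I.endA r₁ r₂ U ≤ I.endB r₁ r₂ U) ∨
    (I.sgn r₁ r₂ U = -1 ∧ I.endB r₁ r₂ U ≤ I.endA r₁ r₂ U) := by
  rw [sgn]
  split_ifs with h
  exacts [Or.inl ⟨rfl, h⟩, Or.inr ⟨rfl, (not_le.1 h).le⟩]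

@[simp]
theorem sgn_mul_sgn_mul (U : H.Rel K a b) (z : ℝ) : I.sgn r₁ r₂ U * (I.sgn r₁ r₂ U * z) = z := by
  rcases sgn_cases (I := I) (r₁ := r₁) (r₂ := r₂) U with ⟨h, -⟩ | ⟨h, -⟩ <;> rw [h] <;> ring

theorem sgn_mul_inj {U : H.Rel K a b} {y z : ℝ} :
    I.sgn r₁ r₂ U * y = I.sgn r₁ r₂ U * z ↔ y = z :=
  ⟨fun h => by rw [← sgn_mul_sgn_mul (I := I) U y, h, sgn_mul_sgn_mul], fun h => h ▸ rfl⟩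

theorem abs_sgn_mul_sub (U : H.Rel K a b) (y z : ℝ) :
    |I.sgn r₁ r₂ U * y - I.sgn r₁ r₂ U * z| = |y - z| := by
  rcases sgn_cases (I := I) (r₁ := r₁) (r₂ := r₂) U with ⟨h, -⟩ | ⟨h, -⟩ <;> rw [h]
  · simp
  · rw [neg_one_mul, neg_one_mul, neg_sub_neg, abs_sub_comm]

theorem mem_uIcc_iff_sgn {U : H.Rel K a b} {g : ℝ → ℝ} (hg : Monotone g) {y : ℝ} :
    y ∈ uIcc (g (I.endA r₁ r₂ U)) (g (I.endB r₁ r₂ U)) ↔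
      I.sgn r₁ r₂ U * y ∈
        Icc (I.sgn r₁ r₂ U * g (I.endA r₁ r₂ U)) (I.sgn r₁ r₂ U * g (I.endB r₁ r₂ U)) := by
  rcases sgn_cases (I := I) (r₁ := r₁) (r₂ := r₂) U with ⟨h, h'⟩ | ⟨h, h'⟩ <;> rw [h]
  · rw [uIcc_of_le (hg h'), one_mul, one_mul, one_mul]
  · rw [uIcc_of_ge (hg h'), mem_Icc, mem_Icc]
    constructor <;> rintro ⟨h1, h2⟩ <;> constructor <;> linarith

theorem notMem_uIcc_endA {U : H.Rel K a b} {y d : ℝ}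
    (hy : y ∈ uIcc (I.endA r₁ r₂ U) (I.endB r₁ r₂ U))
    (h : I.sgn r₁ r₂ U * y < I.sgn r₁ r₂ U * d) : d ∉ uIcc y (I.endA r₁ r₂ U) := by
  rcases sgn_cases (I := I) (r₁ := r₁) (r₂ := r₂) U with ⟨e, h'⟩ | ⟨e, h'⟩ <;> rw [e] at h
  · rw [uIcc_of_le h'] at hy
    rw [uIcc_of_ge hy.1]
    exact fun k => by linarith [k.2]
  · rw [uIcc_of_ge h'] at hy
    rw [uIcc_of_le hy.2]
    exact fun k => by linarith [k.1]

theorem notMem_uIcc_endB {U : H.Rel K a b} {y d : ℝ}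
    (hy : y ∈ uIcc (I.endA r₁ r₂ U) (I.endB r₁ r₂ U))
    (h : I.sgn r₁ r₂ U * d < I.sgn r₁ r₂ U * y) : d ∉ uIcc y (I.endB r₁ r₂ U) := by
  rcases sgn_cases (I := I) (r₁ := r₁) (r₂ := r₂) U with ⟨e, h'⟩ | ⟨e, h'⟩ <;> rw [e] at h
  · rw [uIcc_of_le h'] at hy
    rw [uIcc_of_le hy.2]
    exact fun k => by linarith [k.1]
  · rw [uIcc_of_ge h'] at hy
    rw [uIcc_of_ge hy.1]
    exact fun k => by linarith [k.2]

variable (I) in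
/-- The oriented collapsed intervals. -/
noncomputable def oriented (hR : 0 < R) (hr₁ : radius H R < r₁) (hr₂ : 0 < r₂) :
    OrientedFamily (H.Rel K a b) where
  trans U V := H.Transverse (U : S) V
  orth U V := H.orth U V
  lo U := I.sgn r₁ r₂ U * I.endA r₁ r₂ U
  hi U := I.sgn r₁ r₂ U * I.endB r₁ r₂ U
  d V U := I.sgn r₁ r₂ U * I.hatPt r₁ r₂ V U
  trans_symm := H.transverse_symm
  orth_symm := H.orth_symm _ _
  total U V := by simpa only [Subtype.ext_iff] using! H.total (U : S) V
  trans_not_le h := h.1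
  trans_not_orth h := h.2.2
  orth_not_le := H.orth_not_le _ _
  orth_of_le := H.orth_of_le _ _ _
  lo_le_hi U := by
    rcases sgn_cases (I := I) (r₁ := r₁) (r₂ := r₂) U with ⟨h, h'⟩ | ⟨h, h'⟩ <;> rw [h] <;> linarith
  d_mem {V U} h := (mem_uIcc_iff_sgn monotone_id).1 (hatPt_mem_uIcc hR hr₁ hr₂ h)
  d_trans {U V} h hU hV := by
    simp only [sgn_mul_inj]
    have hU' : I.endA r₁ r₂ U ≠ I.endB r₁ r₂ U := fun e => by simp [e] at hU
    have hV' : I.endA r₁ r₂ V ≠ I.endB r₁ r₂ V := fun e => by simp [e] at hV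
    -- Consistency of `a` and of `b` cannot both be settled in the same interval, since its ends
    -- differ; this leaves the two crossing orders.
    rcases isMark_ma.hatPt_eq_or (I := I) hR hr₁ hr₂ h with h1 | h1 <;>
      rcases isMark_mb.hatPt_eq_or (I := I) hR hr₁ hr₂ h with h2 | h2
    · exact absurd (h1.symm.trans h2) hU'
    · exact Or.inr ⟨h1, h2⟩
    · exact Or.inl ⟨h2, h1⟩
    · exact absurd (h1.symm.trans h2) hV'
  d_nested {U V W} hU hV h := by
    rw [hatPt_eq_of_abs_sub_le hR hr₁ hr₂ (Or.inl hU) (Or.inl hV) (I.δ_nested U V W hU hV h)]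
  d_nested_trans {U V W} h hW ho := by
    have h' := H.transverse_symm h
    have hWU : W < U ∨ H.Transverse (W : S) U := by
      rcases H.total (W : S) U with e | e | e | e | e
      · exact absurd (e ▸ hW.le : (U : S) ≤ V) h.1
      · exact Or.inl e
      · exact absurd (e.trans hW).le h.1
      · exact Or.inr e
      · exact absurd e ho
    rw [hatPt_eq_of_abs_sub_le hR hr₁ hr₂ (Or.inr h') hWU (I.δ_transverse U V W h hW ho)]
  d_orth {U W V} h hU hW := by
    obtain ⟨x, hxU, hxW⟩ := H.exists_near_rho_of_orth a h
    rw [hatPt_eq_of_dist_le hR hr₁ hr₂ hU hW (hxU V hU) (hxW V hW)]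
  d_triple {U V W} hU hW h := by
    -- Consistency for `U` and `W` at a point realizing `V`.
    obtain ⟨x, hx⟩ := H.exists_near_rho a V
    simp only [sgn_mul_inj]
    rcases H.consistent_transverse U W h x with h' | h'
    · exact Or.inr (hatPt_eq_of_dist_le hR hr₁ hr₂ (Or.inr hW) (Or.inr h) (hx W (Or.inr hW)) h')
    · exact Or.inl (hatPt_eq_of_dist_le hR hr₁ hr₂ (Or.inr hU) (Or.inr (H.transverse_symm h))
        (hx U (Or.inr hU)) h')
  d_lt {U V W} hU hW h hlt := sgn_mul_inj.2 (isMark_mb.hatPt_eq hR hr₁ hr₂ hU hW h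
    (notMem_uIcc_endB (hatPt_mem_uIcc hR hr₁ hr₂ (Or.inl hW)) hlt))
  d_gt {U V W} hU hW h hlt := sgn_mul_inj.2 (isMark_ma.hatPt_eq hR hr₁ hr₂ hU hW h
    (notMem_uIcc_endA (hatPt_mem_uIcc hR hr₁ hr₂ (Or.inl hW)) hlt))

theorem complexityLE_oriented (hR : 0 < R) (hr₁ : radius H R < r₁) (hr₂ : 0 < r₂) :
    (I.oriented hR hr₁ hr₂).ComplexityLE H.complexity where
  exists_rank := by
    obtain ⟨rank, h1, h2⟩ := H.exists_rank
    exact ⟨fun U => rank U, fun U V h => h1 h, fun U => h2 U⟩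
  descent m V U h ho := H.le_complexity_of_orth (fun i => V i) (fun i => U i) h ho

variable (I) in
/-- The interval family `G` is obtained from the collapsed intervals by applying `g U` in each
coordinate. -/
structure Represents (r₁ r₂ : ℝ) (G : IntervalFamily (H.Rel K a b)) (g : H.Rel K a b → ℝ → ℝ) :
    Prop where
  carrier_eq : ∀ U, G.carrier U = uIcc (g U (I.endA r₁ r₂ U)) (g U (I.endB r₁ r₂ U))
  pt_eq : ∀ V U : H.Rel K a b, (V < U ∨ H.Transverse (V : S) U) → G.pt V U = {g U (I.hatPt r₁ r₂ V U)}
  map_lo : ∀ U V : H.Rel K a b, U < V → ∀ y ∈ G.carrier V,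
    I.sgn r₁ r₂ V * y < I.sgn r₁ r₂ V * g V (I.hatPt r₁ r₂ U V) →
      G.map V U y = {g U (I.endA r₁ r₂ U)}
  map_hi : ∀ U V : H.Rel K a b, U < V → ∀ y ∈ G.carrier V,
    I.sgn r₁ r₂ V * g V (I.hatPt r₁ r₂ U V) < I.sgn r₁ r₂ V * y →
      G.map V U y = {g U (I.endB r₁ r₂ U)}

/-- By bounded geodesic image, the projection map to a nested domain is constant on each side of
that domain's projection point, with the value of the mark on that side. -/
theorem represents_collapsed (hR : 0 < R) (hr₁ : radius H R < r₁) (hr₂ : 0 < r₂) :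
    I.Represents r₁ r₂ (I.collapsed r₁ r₂) fun _ => id := by
  have hmap : ∀ U V : H.Rel K a b, U < V → ∀ y ∈ (I.collapsed r₁ r₂).carrier V,
      ∀ c m, I.IsMark c m → I.hatPt r₁ r₂ U V ∉ uIcc y (I.q r₁ r₂ V (m V)) →
      (I.collapsed r₁ r₂).map V U y = {I.q r₁ r₂ U (m U)} := by
    rintro U V h _ ⟨s, hs, rfl⟩ c m hm hside
    refine Subset.antisymm ?_ ?_
    · rintro _ ⟨x, hx, rfl⟩
      obtain ⟨s', ⟨hs', e⟩, hx⟩ := mem_iUnion₂.1 hx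
      exact hm.q_eq_of_mem_δmap hR hr₁ hr₂ h hs' (by rwa [e]) hx
    · obtain ⟨x, hx⟩ := (I.δmap_subset V U h s hs).2
      rw [singleton_subset_iff, ← hm.q_eq_of_mem_δmap hR hr₁ hr₂ h hs hside hx]
      exact mem_image_of_mem _ (mem_biUnion (show s ∈ {s | _ ∧ _} from ⟨hs, rfl⟩) hx)
  have hcar : ∀ U, (I.collapsed r₁ r₂).carrier U = uIcc (I.endA r₁ r₂ U) (I.endB r₁ r₂ U) :=
    fun U => q_image hR hr₁ hr₂ U
  refine ⟨hcar, fun V U h => ?_, fun U V h y hy hlt => ?_, fun U V h y hy hlt => ?_⟩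
  · obtain ⟨s, hs⟩ := (I.δ_subset V U h).2
    refine Subset.antisymm ?_ ?_
    · rintro _ ⟨t, ht, rfl⟩
      exact hatPt_eq_q hR hr₁ hr₂ h ht
    · rw [singleton_subset_iff]
      exact ⟨s, hs, hatPt_eq_q hR hr₁ hr₂ h hs⟩
  · exact hmap U V h y hy a I.ma isMark_ma (notMem_uIcc_endA (hcar V ▸ hy) hlt)
  · exact hmap U V h y hy b I.mb isMark_mb (notMem_uIcc_endB (hcar V ▸ hy) hlt)

theorem sgn_mul_le_of_le {U : H.Rel K a b} {g : ℝ → ℝ} (hg : Monotone g) {y z : ℝ}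
    (h : I.sgn r₁ r₂ U * y ≤ I.sgn r₁ r₂ U * z) :
    I.sgn r₁ r₂ U * g y ≤ I.sgn r₁ r₂ U * g z := by
  rcases sgn_cases (I := I) (r₁ := r₁) (r₂ := r₂) U with ⟨e, -⟩ | ⟨e, -⟩ <;> rw [e] at h ⊢
  · have := hg (show y ≤ z by linarith); linarith
  · have := hg (show z ≤ y by linarith); linarith

/-- A strict inequality between images under a monotone map already holds for all preimages, so the
whole fibre over `y` lies on one side and has one value. -/
theorem Represents.push {G : IntervalFamily (H.Rel K a b)} (hG : I.Represents r₁ r₂ G fun _ => id)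
    {g : H.Rel K a b → ℝ → ℝ} (hg : ∀ U, Monotone (g U)) (hc : ∀ U, Continuous (g U)) :
    I.Represents r₁ r₂ (G.push g) g := by
  have hmap : ∀ U V : H.Rel K a b, ∀ y ∈ (G.push g).carrier V, ∀ z,
      (∀ s ∈ G.carrier V, g V s = y → G.map V U s = {z}) → (G.push g).map V U y = {g U z} := by
    rintro U V _ ⟨s, hs, rfl⟩ z hz
    refine Subset.antisymm ?_ ?_
    · rintro _ ⟨x, hx, rfl⟩
      obtain ⟨s', ⟨hs', e⟩, hx⟩ := mem_iUnion₂.1 hx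
      rw [hz s' hs' e] at hx
      exact congrArg _ hx
    · rw [singleton_subset_iff]
      refine mem_image_of_mem _ (mem_biUnion (show s ∈ {s | _ ∧ _} from ⟨hs, rfl⟩) ?_)
      rw [hz s hs rfl]; rfl
  refine ⟨fun U => ?_, fun V U h => ?_, fun U V h y hy hlt => ?_, fun U V h y hy hlt => ?_⟩
  · refine Subset.antisymm ?_ ?_
    · rintro _ ⟨s, hs, rfl⟩
      rw [hG.carrier_eq] at hs
      exact (hg U).mapsTo_uIcc hs
    · refine (intermediate_value_uIcc (hc U).continuousOn).trans (image_mono ?_)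
      exact (hG.carrier_eq U).ge
  · change g U '' _ = _
    rw [hG.pt_eq V U h, image_singleton]; rfl
  · refine hmap U V y hy _ fun s hs e => hG.map_lo U V h s hs ?_
    by_contra! hle
    rw [← e] at hlt
    exact hlt.not_ge (sgn_mul_le_of_le (hg V) hle)
  · refine hmap U V y hy _ fun s hs e => hG.map_hi U V h s hs ?_
    by_contra! hle
    rw [← e] at hlt
    exact hlt.not_ge (sgn_mul_le_of_le (hg V) hle)

variable (I) in
/-- The map `g U` in the oriented coordinate. -/
noncomputable def orientMap (r₁ r₂ : ℝ) (g : H.Rel K a b → ℝ → ℝ) (U : H.Rel K a b) (z : ℝ) : ℝ :=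
  I.sgn r₁ r₂ U * g U (I.sgn r₁ r₂ U * z)

theorem orientMap_monotone {g : H.Rel K a b → ℝ → ℝ} (hg : ∀ U, Monotone (g U))
    (U : H.Rel K a b) : Monotone (I.orientMap r₁ r₂ g U) := fun y z h =>
  sgn_mul_le_of_le (hg U) (by simpa using h)

theorem orientMap_continuous {g : H.Rel K a b → ℝ → ℝ} (hg : ∀ U, Continuous (g U))
    (U : H.Rel K a b) : Continuous (I.orientMap r₁ r₂ g U) :=
  continuous_const.mul ((hg U).comp (continuous_const.mul continuous_id))

/-- The value of a projection map at the projection point itself is irrelevant, since the first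
alternative of consistency holds there. -/
theorem Represents.mem_zeroConsistent_iff {G : IntervalFamily (H.Rel K a b)}
    {g : H.Rel K a b → ℝ → ℝ} (hG : I.Represents r₁ r₂ G g) (hg : ∀ U, Monotone (g U))
    (hR : 0 < R) (hr₁ : radius H R < r₁) (hr₂ : 0 < r₂) {x : H.Rel K a b → ℝ} :
    x ∈ G.zeroConsistent (fun U V => H.Transverse (U : S) V) ↔
      (fun U => I.sgn r₁ r₂ U * x U) ∈
        (I.oriented hR hr₁ hr₂).consistent (I.orientMap r₁ r₂ g) := by
  have hcar : ∀ U, x U ∈ G.carrier U ↔ I.sgn r₁ r₂ U * x U ∈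
        Icc (I.sgn r₁ r₂ U * g U (I.endA r₁ r₂ U)) (I.sgn r₁ r₂ U * g U (I.endB r₁ r₂ U)) :=
    fun U => by rw [hG.carrier_eq, mem_uIcc_iff_sgn (hg U)]
  simp only [OrientedFamily.consistent, oriented, orientMap, sgn_mul_sgn_mul, sgn_mul_inj,
    mem_ofPred_eq, IntervalFamily.zeroConsistent, hcar]
  refine and_congr_right fun hx => and_congr ?_ ?_
  · refine forall₂_congr fun U V => forall_congr' fun h => ?_
    rw [hG.pt_eq V U (Or.inr (H.transverse_symm h)), hG.pt_eq U V (Or.inr h),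
      mem_singleton_iff, mem_singleton_iff]
  · refine forall₂_congr fun U V => forall_congr' fun h => ?_
    rw [hG.pt_eq U V (Or.inl h), mem_singleton_iff]
    have hV := (hcar V).2 (hx V)
    rcases lt_trichotomy (I.sgn r₁ r₂ V * x V) (I.sgn r₁ r₂ V * g V (I.hatPt r₁ r₂ U V))
      with hlt | heq | hlt
    · rw [hG.map_lo U V h _ hV hlt, mem_singleton_iff]
      simp [hlt, hlt.not_gt]
    · simp [sgn_mul_inj.1 heq]
    · rw [hG.map_hi U V h _ hV hlt, mem_singleton_iff]
      simp [hlt, hlt.not_gt]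

theorem orientMap_id : I.orientMap r₁ r₂ (fun _ => id) = fun _ => id := by
  funext U z
  simp [orientMap]

theorem mem_Q_iff (hR : 0 < R) (hr₁ : radius H R < r₁) (hr₂ : 0 < r₂) {x : H.Rel K a b → ℝ} :
    x ∈ I.Q r₁ r₂ ↔ (fun U => I.sgn r₁ r₂ U * x U) ∈
        (I.oriented hR hr₁ hr₂).consistent fun _ => id := by
  rw [Q, (represents_collapsed hR hr₁ hr₂).mem_zeroConsistent_iff (fun _ => monotone_id) hR hr₁ hr₂,
    orientMap_id]

/-! ### Trimming -/

namespace TrimmingSetup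

variable {B : ℝ} {D : I.TrimmingSetup r₁ r₂ B}

theorem collapseAt_mono (U : H.Rel K a b) : Monotone (D.collapseAt U) := collapse_mono _

theorem continuous_collapseAt (U : H.Rel K a b) : Continuous (D.collapseAt U) :=
  continuous_collapse _

theorem mem_Q'_iff (hR : 0 < R) (hr₁ : radius H R < r₁) (hr₂ : 0 < r₂) {x : H.Rel K a b → ℝ} :
    x ∈ D.Q' ↔ (fun U => I.sgn r₁ r₂ U * x U) ∈
        (I.oriented hR hr₁ hr₂).consistent (I.orientMap r₁ r₂ D.collapseAt) :=
  ((represents_collapsed hR hr₁ hr₂).push collapseAt_mono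
    continuous_collapseAt).mem_zeroConsistent_iff collapseAt_mono hR hr₁ hr₂

/-- Trimming shortens a segment without interior collapsed points by a bounded amount. -/
theorem sub_le_collapseAt_sub_add (hR : 0 < R) (hr₁ : radius H R < r₁) (hr₂ : 0 < r₂)
    (hB : 0 ≤ B) {U : H.Rel K a b} {s t : ℝ} (hst : s ≤ t)
    (hs : s ∈ uIcc (I.endA r₁ r₂ U) (I.endB r₁ r₂ U))
    (ht : t ∈ uIcc (I.endA r₁ r₂ U) (I.endB r₁ r₂ U))
    (h : ∀ V, V < U → I.hatPt r₁ r₂ V U ∉ Ioo s t) :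
    t - s ≤ D.collapseAt U t - D.collapseAt U s + B * B := by
  rcases hst.eq_or_lt with rfl | hlt
  · simpa using mul_nonneg hB hB
  have hs0 : 0 ≤ s := by
    rw [← q_image hR hr₁ hr₂] at hs
    obtain ⟨z, -, rfl⟩ := hs
    exact ENNReal.toReal_nonneg
  -- Every cluster contains a base point: the marks collapse to the ends and the others to nested
  -- projections, so the open segment meets no collapsed point.
  have hedge : Ioo s t ⊆ I.edgePart r₁ r₂ U := by
    intro z hz
    refine ⟨(q_image hR hr₁ hr₂ U).ge (ordConnected_uIcc.out hs ht (Ioo_subset_Icc_self hz)), ?_⟩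
    rintro ⟨c, hc, rfl⟩
    obtain ⟨y, hy, e⟩ := exists_isBase_of_mem_clusters hR hr₂ ((le_radius hR).trans hr₁.le) hc
    rw [e] at hz
    have hend : I.q r₁ r₂ U y ≠ I.endA r₁ r₂ U ∧ I.q r₁ r₂ U y ≠ I.endB r₁ r₂ U := by
      rw [mem_uIcc] at hs ht
      constructor <;> intro e <;> rw [e] at hz <;> obtain ⟨hz1, hz2⟩ := hz <;>
        rcases hs with hs | hs <;> rcases ht with ht | ht <;> linarith
    rcases hy with rfl | rfl | ⟨V, hV, hy⟩
    · exact hend.1 rfl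
    · exact hend.2 rfl
    · rw [hatPt_eq_q hR hr₁ hr₂ (Or.inl hV) hy] at hz
      exact h V hV hz
  obtain ⟨z₀, hz₀⟩ : (Ioo s t).Nonempty := nonempty_Ioo.2 hlt
  set e := connectedComponentIn (I.edgePart r₁ r₂ U) z₀ with he
  have hee : e ∈ I.edgeComponents r₁ r₂ U := ⟨z₀, hedge hz₀, rfl⟩
  have hIe : Ioo s t ⊆ e := isPreconnected_Ioo.subset_connectedComponentIn hz₀ hedge
  obtain ⟨hfin, hcard⟩ := D.card_le U e hee
  have hsub : ⋃₀ D.intervals U ∩ Ioo s t ⊆ ⋃ E ∈ hfin.toFinset, E := by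
    rintro z ⟨⟨E, hE, hzE⟩, hz⟩
    refine mem_biUnion (Finset.mem_coe.2 (hfin.mem_toFinset.2 ⟨hE, ?_⟩)) hzE
    obtain ⟨e', ⟨z', hz', rfl⟩, hEe'⟩ := D.subset_edge U E hE
    obtain ⟨p, p', hpp', rfl, -⟩ := D.isInterval U E hE
    -- A nondegenerate trimming interval that meets the open segment shares an open set with it, so
    -- its edge component is `e`.
    obtain ⟨y, hy⟩ : (Ioo p p' ∩ Ioo s t).Nonempty := by
      have : z ∈ closure (Ioo p p') := by rw [closure_Ioo hpp'.ne]; exact hzE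
      obtain ⟨y, h1, h2⟩ := mem_closure_iff.1 this _ isOpen_Ioo hz
      exact ⟨y, h2, h1⟩
    obtain ⟨y', h1, h2⟩ := mem_closure_iff.1 (hEe' (Ioo_subset_Icc_self hy.1)) _
      (isOpen_Ioo.inter isOpen_Ioo) hy
    rwa [he, connectedComponentIn_eq (hIe h1.2), ← connectedComponentIn_eq h2]
  have := sub_le_collapse_sub_add (A := ⋃₀ D.intervals U) hs0 hst hB hfin.toFinset (fun E hE => by
    obtain ⟨p, p', hpp', rfl, hlen⟩ := D.isInterval U E (hfin.mem_toFinset.1 hE).1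
    rw [Real.volume_Icc]
    exact ENNReal.ofReal_le_ofReal hlen.le) hsub
  rw [Set.ncard_eq_toFinset_card _ hfin] at hcard
  exact this.trans (add_le_add le_rfl (mul_le_mul_of_nonneg_right hcard hB))

/-- An edge component holds at most `B` intervals, hence none. This case allows the threshold to be
positive even for small `K`. -/
theorem intervals_eq_empty (hB : B < 1) (U : H.Rel K a b) : D.intervals U = ∅ := by
  refine eq_empty_of_forall_notMem fun E hE => ?_
  obtain ⟨e, he, hEe⟩ := D.subset_edge U E hE
  obtain ⟨hfin, hcard⟩ := D.card_le U e he
  have h1 : 0 < {D' ∈ D.intervals U | D' ⊆ closure e}.ncard :=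
    (ncard_pos hfin).2 ⟨E, hE, hEe⟩
  have h2 : (1 : ℝ) ≤ {D' ∈ D.intervals U | D' ⊆ closure e}.ncard := by exact_mod_cast h1
  linarith

theorem collapseAt_eq_self (hB : B < 1) (U : H.Rel K a b) {t : ℝ} (ht : 0 ≤ t) :
    D.collapseAt U t = t := by
  have := collapse_of_disjoint (A := ⋃₀ D.intervals U) (s := 0) le_rfl ht
    (by rw [intervals_eq_empty hB, sUnion_empty]; exact empty_disjoint _)
  rwa [collapse_of_nonpos _ le_rfl, sub_zero, sub_zero] at this

theorem mapsTo_Δ (hR : 0 < R) (hr₁ : radius H R < r₁) (hr₂ : 0 < r₂) :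
    MapsTo D.Δ (I.Q r₁ r₂) D.Q' := by
  intro x hx
  rw [mem_Q_iff hR hr₁ hr₂] at hx
  rw [mem_Q'_iff hR hr₁ hr₂]
  have := OrientedFamily.map_mem_consistent
    (orientMap_monotone (I := I) (r₁ := r₁) (r₂ := r₂) (g := D.collapseAt) collapseAt_mono) hx
  simpa only [orientMap, sgn_mul_sgn_mul] using! this

theorem exists_lift (hR : 0 < R) (hr₁ : radius H R < r₁) (hr₂ : 0 < r₂) {y : H.Rel K a b → ℝ}
    (hy : y ∈ D.Q') : ∃ x ∈ I.Q r₁ r₂, D.Δ x = y := by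
  rw [mem_Q'_iff hR hr₁ hr₂] at hy
  obtain ⟨x, hx, hxy⟩ := OrientedFamily.exists_lift (orientMap_monotone collapseAt_mono)
    (orientMap_continuous continuous_collapseAt) hy
  refine ⟨fun U => I.sgn r₁ r₂ U * x U, ?_, funext fun U => ?_⟩
  · rw [mem_Q_iff hR hr₁ hr₂]
    simpa using hx
  · exact sgn_mul_inj.1 (congrFun hxy U)

theorem l1Dist_Δ_le [Fintype (H.Rel K a b)] (x x' : H.Rel K a b → ℝ) :
    l1Dist (D.Δ x) (D.Δ x') ≤ l1Dist x x' := by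
  rw [l1Dist, l1Dist, finsum_eq_sum_of_fintype, finsum_eq_sum_of_fintype]
  exact Finset.sum_le_sum fun U _ => abs_collapse_sub_le _ _ _

theorem l1Dist_Δ_eq (hB : B < 1) {x x' : H.Rel K a b → ℝ} (hx : x ∈ I.Q r₁ r₂) (hx' : x' ∈ I.Q r₁ r₂) :
    l1Dist (D.Δ x) (D.Δ x') = l1Dist x x' := by
  have h0 : ∀ x ∈ I.Q r₁ r₂, D.Δ x = x := by
    intro x hx
    funext U
    refine collapseAt_eq_self hB U ?_
    obtain ⟨z, -, hz⟩ := hx.1 U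
    rw [← hz]
    exact ENNReal.toReal_nonneg
  rw [h0 x hx, h0 x' hx']

theorem l1Dist_le (hR : 0 < R) (hr₁ : radius H R < r₁) (hr₂ : 0 < r₂) (hB : 0 ≤ B)
    (hBK : B * B + 1 + 2 * r₁ + r₂ ≤ (K - 3 * R) / R) [Fintype (H.Rel K a b)]
    {x x' : H.Rel K a b → ℝ} (hx : x ∈ I.Q r₁ r₂) (hx' : x' ∈ I.Q r₁ r₂) :
    l1Dist x x' ≤ (1 + 2 * (B * B * (H.complexity * (H.complexity * 3 * (H.complexity + 2) + 1)))) *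
      (l1Dist (D.Δ x) (D.Δ x') + 1) := by
  rw [mem_Q_iff hR hr₁ hr₂] at hx hx'
  have hloss : ∀ U s t, (I.oriented hR hr₁ hr₂).lo U ≤ s → s ≤ t →
      t ≤ (I.oriented hR hr₁ hr₂).hi U →
      (∀ V, V < U → (I.oriented hR hr₁ hr₂).d V U ∉ Ioo s t) →
      t - s ≤ I.orientMap r₁ r₂ D.collapseAt U t - I.orientMap r₁ r₂ D.collapseAt U s + B * B := by
    intro U s t h1 h2 h3 h4
    have hs : I.sgn r₁ r₂ U * s ∈ uIcc (I.endA r₁ r₂ U) (I.endB r₁ r₂ U) :=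
      (mem_uIcc_iff_sgn monotone_id).2 (by rw [sgn_mul_sgn_mul]; exact ⟨h1, h2.trans h3⟩)
    have ht : I.sgn r₁ r₂ U * t ∈ uIcc (I.endA r₁ r₂ U) (I.endB r₁ r₂ U) :=
      (mem_uIcc_iff_sgn monotone_id).2 (by rw [sgn_mul_sgn_mul]; exact ⟨h1.trans h2, h3⟩)
    simp only [oriented, orientMap] at h4 ⊢
    rcases sgn_cases (I := I) (r₁ := r₁) (r₂ := r₂) U with ⟨e, -⟩ | ⟨e, -⟩ <;>
      simp only [e, one_mul, neg_one_mul] at hs ht h4 ⊢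
    · exact sub_le_collapseAt_sub_add hR hr₁ hr₂ hB h2 hs ht h4
    -- The orientation is reversed here, so the segment is reflected.
    · have := sub_le_collapseAt_sub_add (D := D) hR hr₁ hr₂ hB (neg_le_neg h2) ht hs
        fun V hV hm => h4 V hV ⟨by linarith [hm.2], by linarith [hm.1]⟩
      linarith
  have hlarge : ∀ U, IsMin U → (I.oriented hR hr₁ hr₂).lo U < (I.oriented hR hr₁ hr₂).hi U ∧
      1 ≤ I.orientMap r₁ r₂ D.collapseAt U ((I.oriented hR hr₁ hr₂).hi U) -
        I.orientMap r₁ r₂ D.collapseAt U ((I.oriented hR hr₁ hr₂).lo U) := by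
    intro U hU
    have hle := (I.oriented hR hr₁ hr₂).lo_le_hi U
    -- A minimal domain has no nested projections, so its whole interval counts as one segment and
    -- loses at most `B * B`; `hBK` leaves length at least `1`.
    have h1 := hloss U _ _ le_rfl hle le_rfl fun V hV => absurd hV hU.not_lt
    have h2 := le_abs_endA_sub_endB (I := I) ((radius_pos (H := H) hR).trans hr₁).le hr₂ hU
    have h3 := lt_abs_sub_marks (I := I) hR U
    rw [abs_sub_comm (I.endA r₁ r₂ U),
      ← abs_sgn_mul_sub (I := I) (r₁ := r₁) (r₂ := r₂) U (I.endB r₁ r₂ U)] at h2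
    have h4 : |(I.oriented hR hr₁ hr₂).hi U - (I.oriented hR hr₁ hr₂).lo U| =
      (I.oriented hR hr₁ hr₂).hi U - (I.oriented hR hr₁ hr₂).lo U := abs_of_nonneg (by linarith)
    have h5 : |I.ma U - I.mb U| - 2 * r₁ - r₂ ≤
      |(I.oriented hR hr₁ hr₂).hi U - (I.oriented hR hr₁ hr₂).lo U| := h2
    have h6 : 0 ≤ B * B := mul_nonneg hB hB
    constructor <;> linarith
  have := OrientedFamily.sum_abs_sub_le_of_consistent (complexityLE_oriented hR hr₁ hr₂)
    (orientMap_monotone (g := D.collapseAt) collapseAt_mono) (mul_nonneg hB hB) hloss hlarge hx hx'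
  simp only [orientMap, sgn_mul_sgn_mul, abs_sgn_mul_sub] at this
  rwa [l1Dist, l1Dist, finsum_eq_sum_of_fintype, finsum_eq_sum_of_fintype]

end TrimmingSetup

end IntervalSystem

end

/-! ### The trimming theorem -/

theorem mainTheorem7 {X : Type*} [MetricSpace X] {S : Type*} [PartialOrder S]
    {C : S → Type*} [∀ U, MetricSpace (C U)] (H : HHS X S C) :
    ∃ K₀ : ℝ, 0 < K₀ ∧ ∀ R : ℝ, 0 < R →
    ∃ R₁ R₂ : ℝ, 0 < R₁ ∧ 0 < R₂ ∧ ∀ r₁ r₂ : ℝ, R₁ < r₁ → R₂ < r₂ →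
    ∃ Btt L : ℝ → ℝ,
      (∀ K, K₀ ≤ K → 0 < Btt K) ∧ Filter.Tendsto Btt Filter.atTop Filter.atTop ∧
      (∀ B, 0 < B → 0 < L B) ∧
      ∀ K B : ℝ, K₀ ≤ K → 0 < B → B < Btt K →
      ∀ (a b : X) (I : IntervalSystem H R K a b) (D : I.TrimmingSetup r₁ r₂ B),
        (H.Rel K a b).Finite ∧
        Set.MapsTo D.Δ (I.Q r₁ r₂) D.Q' ∧
        (∃ Ξ : (H.Rel K a b → ℝ) → (H.Rel K a b → ℝ),
          Set.MapsTo Ξ D.Q' (I.Q r₁ r₂) ∧ ∀ y ∈ D.Q', D.Δ (Ξ y) = y) ∧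
        D.Δ '' I.Q r₁ r₂ = D.Q' ∧
        IsQuasiIsometry (L B) (I.Q r₁ r₂) D.Q' l1Dist l1Dist D.Δ := by
  -- `K₀ = E` is what finiteness by large links needs. Of `r₂` only positivity matters, so `R₂ = 1`
  -- is arbitrary.
  refine ⟨H.E, zero_lt_one.trans_le H.one_le_E, fun R hR =>
    ⟨IntervalSystem.radius H R, 1, IntervalSystem.radius_pos hR, one_pos, fun r₁ r₂ hr₁ hr₂ => ?_⟩⟩
  have hr₂' : 0 < r₂ := one_pos.trans hr₂
  set N : ℝ := H.complexity * (H.complexity * 3 * (H.complexity + 2) + 1) with hN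
  have hN0 : 0 ≤ N := by positivity
  -- The square root is the largest `B` for which minimal intervals keep length `1`; the floor `1 /
  -- 2` only admits further `B < 1`, where nothing is trimmed.
  refine ⟨fun K => max (1 / 2) (Real.sqrt ((K - 3 * R) / R - (1 + 2 * r₁ + r₂))),
    fun B => 1 + 2 * (B * B * N), fun K _ => lt_max_of_lt_left (by norm_num), ?_,
    fun B _ => by have := mul_self_nonneg B; positivity, ?_⟩
  · refine tendsto_atTop_mono (fun K => le_max_right _ _) (Real.tendsto_sqrt_atTop.comp ?_)
    refine tendsto_atTop_add_const_right _ _ (Tendsto.atTop_div_const hR ?_)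
    exact tendsto_atTop_add_const_right _ _ tendsto_id
  intro K B hK hB hBK a b I D
  have hfin := H.finite_Rel hK a b
  have : Fintype (H.Rel K a b) := hfin.fintype
  have hmaps := D.mapsTo_Δ hR hr₁ hr₂'
  have hlift : ∀ y, ∃ x, y ∈ D.Q' → x ∈ I.Q r₁ r₂ ∧ D.Δ x = y := by
    intro y
    by_cases hy : y ∈ D.Q'
    · obtain ⟨x, hx, hxy⟩ := D.exists_lift hR hr₁ hr₂' hy
      exact ⟨x, fun _ => ⟨hx, hxy⟩⟩
    · exact ⟨y, fun h => absurd h hy⟩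
  choose Ξ hΞ using hlift
  have hk : 0 ≤ B * B * N := mul_nonneg (mul_self_nonneg B) hN0
  have hL : 1 ≤ 1 + 2 * (B * B * N) := by linarith
  have hl1 : ∀ x y : H.Rel K a b → ℝ, 0 ≤ l1Dist x y := fun x y =>
    finsum_nonneg fun U => abs_nonneg _
  refine ⟨hfin, hmaps, ⟨Ξ, fun y hy => (hΞ y hy).1, fun y hy => (hΞ y hy).2⟩,
    Subset.antisymm hmaps.image_subset fun y hy => ⟨Ξ y, hΞ y hy⟩, hmaps, ?_, ?_⟩
  · intro x hx y hy
    have hle : l1Dist x y ≤ (1 + 2 * (B * B * N)) * (l1Dist (D.Δ x) (D.Δ y) + 1) := by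
      rcases lt_or_ge B 1 with hB1 | hB1
      · rw [D.l1Dist_Δ_eq hB1 hx hy]
        nlinarith [hl1 x y]
      · refine D.l1Dist_le hR hr₁ hr₂' hB.le ?_ hx hy
        have h1 := (lt_max_iff.1 hBK).resolve_left (by linarith)
        have h2 := (Real.lt_sqrt hB.le).1 h1
        nlinarith
    have hΔ := D.l1Dist_Δ_le x y
    refine ⟨?_, by nlinarith [hl1 x y]⟩
    have h1 : (1 + 2 * (B * B * N))⁻¹ * l1Dist x y ≤ l1Dist (D.Δ x) (D.Δ y) + 1 := by
      rwa [inv_mul_le_iff₀ (by linarith)]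
    linarith
  · intro z hz
    refine ⟨Ξ z, (hΞ z hz).1, ?_⟩
    rw [(hΞ z hz).2]
    simpa [l1Dist] using by linarith
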